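/- A $[p,n,k]$ complex orthogonal design (COD) is a $p\times n$ matrix $\mathcal O$ whose entries are $0$, $\pm z_i$ or $\pm z_i^*$ ($1\le i\le k$), with $z_1,\dots,z_k$ complex indeterminates, such that $\mathcal O^H\mathcal O=(|z_1|^2+\dots+|z_k|^2)I_n$. Its rate is $k/p$ and its delay is $p$. A COD has maximal rate if no COD with the same number $n$ of columns has larger rate; it has maximal rate and minimal delay if moreover no maximal-rate COD with $n$ columns has smaller delay. Two CODs are equivalent if one is obtained from the other by finitely many of the following operations: permuting the rows, permuting the columns, conjugating all instances of a variable, negating all instances of a variable, renaming the variables (by a permutation of their indices), multiplying a row by $-1$, multiplying a column by $-1$. For $m\ge 1$ let $\mathcal G_{2m-1}$ be the matrix with rows indexed by the vectors $\alpha\in\mathbb F_2^{2m}$ of weight $m+1$, columns indexed by $i=1,\dots,2m-1$, and variables $z_\gamma$ indexed by the vectors $\gamma\in\mathbb F_2^{2m}$ of weight $m$ with $\gamma(2m)=0$, whose $(\alpha,i)$ entry is $(-1)^{\theta(\alpha,i)}z_{\alpha\oplus e_i}$ if $\alpha(i)=1$ and $\alpha(2m)=0$; $(-1)^{\theta(\alpha,i)}z^*_{\alpha\oplus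 e_i\oplus e}$ if $\alpha(i)=1$ and $\alpha(2m)=1$; and $0$ if $\alpha(i)=0$. Here $e_i$ is the $i$-th unit vector, $e$ is the all-ones vector, and $\theta(\alpha,i)=\sum_{t=i}^{2m}\alpha(t)+\frac i2$ for $i$ even, $\theta(\alpha,i)=\sum_{t=i}^{2m}\alpha(t)+\frac{i-1}2+\alpha(2m)$ for $i$ odd. **Corollary.** (1) Let $n\ge1$ with $n\equiv 0$, $1$ or $3\pmod 4$. Any two maximal-rate, minimal-delay CODs with $n$ columns have the same parameters $[p,n,k]$ and are equivalent. (2) Let $m\ge1$. Then $\mathcal G_{2m-1}$ is a maximal-rate, minimal-delay COD with $2m-1$ columns, and every COD with parameters $\left[\binom{2m}{m-1},2m-1,\binom{2m-1}{m-1}\right]$ is equivalent to $\mathcal G_{2m-1}$ (after labelling its rows and variables by the index sets of $\mathcal G_{2m-1}$). (3) Let $m\ge 2$ be even. There is a column $\mathcal L$, with entries $0$, $\pm z_\gamma$ or $\pm z_\gamma^*$ in the variables of $\mathcal G_{2m-1}$, such that $(\mathcal G_{2m-1},\mathcal L)$ is a COD with $2m$ columns. For every such $\mathcal L$ the COD $(\mathcal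 G_{2m-1},\mathcal L)$ has maximal rate and minimal delay, and there is a function $\phi$ from the rows to $\mathbb F_2$ such that $\mathcal L(\alpha)=(-1)^{\phi(\alpha)}z_{\alpha\oplus e_{2m}}$ if $\alpha(2m)=1$ and $\mathcal L(\alpha)=0$ if $\alpha(2m)=0$. The function $\phi$ is unique up to global negation: if $\phi$ and $\phi'$ both give CODs in this way, then either $\phi'(\alpha)=\phi(\alpha)$ for all rows $\alpha$ with $\alpha(2m)=1$, or $\phi'(\alpha)=\phi(\alpha)\oplus1$ for all rows $\alpha$ with $\alpha(2m)=1$. -/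

import Mathlib

open scoped Matrix

namespace COD

/-- A formal entry `0`, `± z_i` or `± z_i^*` of a complex orthogonal design whose variables
are indexed by `κ`. In `var s conj i` the unit `s` is the sign, and `conj` says whether the
variable `z_i` is conjugated. -/
inductive Entry (κ : Type) : Type
  | zero : Entry κ
  | var (s : ℤˣ) (conj : Bool) (i : κ) : Entry κ

namespace Entry

variable {κ κ' : Type}

/-- The complex number obtained from an entry by giving values to the variables. -/
noncomputable def eval (z : κ → ℂ) : Entry κ → ℂ
  | zero => 0
  | var s c i => ((s : ℤ) : ℂ) * (if c then star (z i) else z i)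

/-- Multiplication of an entry by `-1`. -/
def neg : Entry κ → Entry κ
  | zero => zero
  | var s c i => var (-s) c i

/-- Conjugation of the variable `z_j`, if it occurs in the entry. -/
def conjVar [DecidableEq κ] (j : κ) : Entry κ → Entry κ
  | zero => zero
  | var s c i => if i = j then var s (!c) i else var s c i

/-- Negation of the variable `z_j`, if it occurs in the entry. -/
def negVar [DecidableEq κ] (j : κ) : Entry κ → Entry κ
  | zero => zero
  | var s c i => if i = j then var (-s) c i else var s c i

/-- Change of the index of the variable. -/
def rename (f : κ → κ') : Entry κ → Entry κ'
  | zero => zero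
  | var s c i => var s c (f i)

end Entry

/-- `O` is a complex orthogonal design (with rows indexed by `ρ`, columns indexed by `ι` and
variables indexed by `κ`): the identity `Oᴴ O = (∑ |z_i|²) I` holds identically in the
variables `z_i`. A `[p, n, k]` design is the case `ρ = Fin p`, `ι = Fin n`, `κ = Fin k`. -/
def IsCOD {ρ ι κ : Type} [Fintype ρ] [DecidableEq ι] [Fintype κ]
    (O : Matrix ρ ι (Entry κ)) : Prop :=
  ∀ z : κ → ℂ, (O.map (Entry.eval z))ᴴ * O.map (Entry.eval z) =
    ((∑ i, ‖z i‖ ^ 2 : ℝ) : ℂ) • (1 : Matrix ι ι ℂ)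

/-- A design whose code rate `k / p` is the largest among all designs with the same columns. -/
def IsMaxRate {ρ ι κ : Type} [Fintype ρ] [DecidableEq ι] [Fintype κ]
    (O : Matrix ρ ι (Entry κ)) : Prop :=
  IsCOD O ∧ ∀ (p k : ℕ) (O' : Matrix (Fin p) ι (Entry (Fin k))), IsCOD O' →
    (k : ℚ) / p ≤ (Fintype.card κ : ℚ) / Fintype.card ρ

/-- A maximal-rate, minimal-delay design: it has maximal rate, and its delay `p` is the
smallest among all maximal-rate designs with the same columns. -/
def IsOptimal {ρ ι κ : Type} [Fintype ρ] [DecidableEq ι] [Fintype κ]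
    (O : Matrix ρ ι (Entry κ)) : Prop :=
  IsMaxRate O ∧ ∀ (p k : ℕ) (O' : Matrix (Fin p) ι (Entry (Fin k))), IsMaxRate O' →
    Fintype.card ρ ≤ p

/-- The seven equivalence operations on a design. -/
inductive EquivOp {ρ ι κ : Type} [DecidableEq ρ] [DecidableEq ι] [DecidableEq κ] :
    Matrix ρ ι (Entry κ) → Matrix ρ ι (Entry κ) → Prop
  | rowPermutation (O : Matrix ρ ι (Entry κ)) (σ : Equiv.Perm ρ) :
      EquivOp O (O.submatrix σ id)
  | columnPermutation (O : Matrix ρ ι (Entry κ)) (σ : Equiv.Perm ι) :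
      EquivOp O (O.submatrix id σ)
  | instanceConjugation (O : Matrix ρ ι (Entry κ)) (j : κ) :
      EquivOp O (O.map (Entry.conjVar j))
  | instanceNegation (O : Matrix ρ ι (Entry κ)) (j : κ) :
      EquivOp O (O.map (Entry.negVar j))
  | instanceRenaming (O : Matrix ρ ι (Entry κ)) (σ : Equiv.Perm κ) :
      EquivOp O (O.map (Entry.rename σ))
  | rowNegation (O : Matrix ρ ι (Entry κ)) (r : ρ) :
      EquivOp O (Matrix.of fun r' c => if r' = r then (O r' c).neg else O r' c)
  | columnNegation (O : Matrix ρ ι (Entry κ)) (c : ι) :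
      EquivOp O (Matrix.of fun r c' => if c' = c then (O r c').neg else O r c')

/-- Two designs are the same under equivalence operations: after the rows, columns and
variables of the first are labelled by the index sets of the second (so the parameters
`[p, n, k]` agree), finitely many equivalence operations lead from the first to the second. -/
def Equivalent {ρ ι κ ρ' ι' κ' : Type} [DecidableEq ρ'] [DecidableEq ι'] [DecidableEq κ']
    (O : Matrix ρ ι (Entry κ)) (O' : Matrix ρ' ι' (Entry κ')) : Prop :=
  ∃ (a : ρ ≃ ρ') (b : ι ≃ ι') (f : κ ≃ κ'),
    Relation.ReflTransGen EquivOp ((O.submatrix a.symm b.symm).map (Entry.rename f)) O'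

/-! The design `G_{2m-1}`. Throughout, `m = q + 1`. A vector of `𝔽₂^{2m}` is given by its
support, a subset of `Fin (2 * q + 2)`; the bits `1, …, 2m` are the elements `0, …, 2q + 1`
of `Fin (2 * q + 2)`, and bit `2m` is `Fin.last`. -/

/-- The rows of `G_{2m-1}`: vectors of `𝔽₂^{2m}` of weight `m + 1`. -/
abbrev GRow (q : ℕ) : Type := {α : Finset (Fin (2 * q + 2)) // α.card = q + 2}

/-- The variables of `G_{2m-1}`: vectors of `𝔽₂^{2m}` of weight `m` with last bit `0`. -/
abbrev GVar (q : ℕ) : Type :=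
  {γ : Finset (Fin (2 * q + 2)) // γ.card = q + 1 ∧ Fin.last (2 * q + 1) ∉ γ}

/-- The exponent `θ(α, i)`, where the 1-based index of the bit is `i + 1`. -/
def theta {q : ℕ} (α : Finset (Fin (2 * q + 2))) (i : Fin (2 * q + 2)) : ℕ :=
  if Even (i.val + 1) then
    (α.filter fun t => i ≤ t).card + (i.val + 1) / 2
  else
    (α.filter fun t => i ≤ t).card + i.val / 2 +
      (if Fin.last (2 * q + 1) ∈ α then 1 else 0)

theorem card_erase_gRow {q : ℕ} (α : GRow q) {i : Fin (2 * q + 2)} (hi : i ∈ α.1) :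
    (α.1.erase i).card = q + 1 := by
  rw [Finset.card_erase_of_mem hi, α.2]; rfl

theorem card_erase_compl_gRow {q : ℕ} (α : GRow q) {i : Fin (2 * q + 2)} (hi : i ∈ α.1) :
    ((α.1.erase i)ᶜ).card = q + 1 := by
  rw [Finset.card_compl, card_erase_gRow α hi, Fintype.card_fin]; omega

/-- The design `G_{2m-1}`: the entry in row `α` and column `i` is
`(-1)^θ(α,i) z_{α ⊕ e_i}` if `α(i) = 1`, `α(2m) = 0`;
`(-1)^θ(α,i) z^*_{α ⊕ e_i ⊕ e}` if `α(i) = 1`, `α(2m) = 1`; and `0` if `α(i) = 0`. -/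
def G (q : ℕ) : Matrix (GRow q) (Fin (2 * q + 1)) (Entry (GVar q)) :=
  Matrix.of fun α i =>
    if hi : i.castSucc ∈ α.1 then
      if hl : Fin.last (2 * q + 1) ∈ α.1 then
        Entry.var ((-1) ^ theta α.1 i.castSucc) true
          ⟨(α.1.erase i.castSucc)ᶜ, card_erase_compl_gRow α hi, by
            simpa [Finset.mem_compl, Finset.mem_erase] using
              And.intro (Fin.castSucc_lt_last i).ne' hl⟩
      else
        Entry.var ((-1) ^ theta α.1 i.castSucc) false
          ⟨α.1.erase i.castSucc, card_erase_gRow α hi, fun h => hl (Finset.mem_of_mem_erase h)⟩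
    else Entry.zero

/-- The matrix `(G_{2m-1}, L)` with one more column `L`. -/
def appendColumn (q : ℕ) (L : GRow q → Entry (GVar q)) :
    Matrix (GRow q) (Fin (2 * q + 2)) (Entry (GVar q)) :=
  Matrix.of fun α => Fin.snoc (α := fun _ => Entry (GVar q)) (G q α) (L α)

/-- The column `α(2m) (-1)^φ(α) z_{α ⊕ e_{2m}}` with sign function `φ`. -/
def extraColumn (q : ℕ) (φ : GRow q → ZMod 2) (α : GRow q) : Entry (GVar q) :=
  if hl : Fin.last (2 * q + 1) ∈ α.1 then
    Entry.var ((-1) ^ (φ α).val) false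
      ⟨α.1.erase (Fin.last (2 * q + 1)), card_erase_gRow α hl, Finset.notMem_erase _ _⟩
  else Entry.zero

end COD

open scoped symmDiff

namespace COD

variable {ρ ι κ : Type}

/-! Setting all but one or two variables to zero shows that each column contains each variable
exactly once, and that two nonzero entries of a row always lie in an Alamouti block: a second row
carries the same two variables with the columns interchanged, both conjugations flipped, and the
product of the four signs is `-1` (`IsCOD.alamouti`). Conversely, these properties imply
orthogonality (`IsCOD.of_alamouti`).

Let there be `2q + 1` columns. If row `r` contains `z_i` in column `c`, then `z_i` has the opposite
conjugation in every other column of the support of `r`. This bounds row weights by conjugation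
counts, and double counting writes a multiple of `(q + 2) p - (2q + 2) k` as a sum of nonnegative
terms (`IsCOD.defect_identity`). Hence the rate is at most `(q + 2) / (2q + 2)`, and equality makes
every term vanish.

In the equality case a variable is labelled by the `q + 1` columns carrying its more frequent
conjugation type, and a row by its support or the complement of it, a set of size `q + 2` or `q`. A
nonzero entry in column `c` joins labels that differ exactly in `c`, so the design lives on the
edges of three middle levels of the cube of subsets of the columns. Exchanging elements along rows
reaches every `(q + 1)`-set (`IsCOD.exists_label_eq`), which bounds `k`, and so the delay, from
below. At the minimum the labels are bijective, and two designs differ only by signs and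
conjugations. The ratio of their signs is an edge function with product `1` on each Alamouti square;
`exists_potential` makes it a coboundary, that is, a combination of row and variable negations
(`IsCOD.signEquivalent`).

The design `G` attains both bounds. For `2q + 2` columns the bounds follow by deleting a column, and
they are attained when `q + 1` is even because `G` then extends. In an extension of `G` the Alamouti
conditions force the positions and conjugations of the last column and leave one global sign, which
a column negation absorbs. -/

theorem Entry.eval_eq_zero {e : Entry κ} {z : κ → ℂ}
    (h : ∀ s a i, e = .var s a i → z i = 0) : e.eval z = 0 := by
  cases e with
  | zero => rfl
  | var s a i => simp [Entry.eval, h s a i rfl]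

theorem Entry.star_eval_mul_eval (z : κ → ℂ) (s : ℤˣ) (a : Bool) (i : κ) :
    star ((Entry.var s a i).eval z) * (Entry.var s a i).eval z = ((‖z i‖ ^ 2 : ℝ) : ℂ) := by
  have h1 : star (z i) * z i = ((‖z i‖ ^ 2 : ℝ) : ℂ) := by
    rw [Complex.star_def, Complex.conj_mul']; norm_cast
  rcases Int.units_eq_one_or s with rfl | rfl <;> cases a <;>
    simp only [Entry.eval] <;> rw [← h1] <;> simp [mul_comm]

theorem isCOD_iff [Fintype ρ] [DecidableEq ι] [Fintype κ] {O : Matrix ρ ι (Entry κ)} :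
    IsCOD O ↔ ∀ (z : κ → ℂ) (c c' : ι), ∑ r, star ((O r c).eval z) * (O r c').eval z =
      if c = c' then ((∑ i, ‖z i‖ ^ 2 : ℝ) : ℂ) else 0 := by
  unfold IsCOD
  refine forall_congr' fun z => ?_
  rw [← Matrix.ext_iff]
  refine forall_congr' fun c => forall_congr' fun c' => ?_
  simp only [Matrix.mul_apply, Matrix.conjTranspose_apply, Matrix.map_apply, Matrix.smul_apply,
    Matrix.one_apply, smul_eq_mul, mul_ite, mul_one, mul_zero]

/-! ### Alamouti blocks -/

namespace IsCOD

section

variable [Fintype ρ] [DecidableEq ι] [Fintype κ] {O : Matrix ρ ι (Entry κ)}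

theorem existsUnique_row (h : IsCOD O) (c : ι) (i : κ) :
    ∃! r, ∃ s a, O r c = .var s a i := by
  classical
  -- At `z_i = 1`, with all other variables `0`, the squared norm of the column counts the rows that
  -- contain `z_i`.
  have h1 := isCOD_iff.1 h (Pi.single i 1) c c
  have h2 : ∀ r, star ((O r c).eval (Pi.single i 1)) * (O r c).eval (Pi.single i 1) =
      if (∃ s a, O r c = .var s a i) then (1 : ℂ) else 0 := by
    intro r
    split_ifs with hr
    · obtain ⟨s, a, hr⟩ := hr
      rw [hr, Entry.star_eval_mul_eval]; simp
    · rw [Entry.eval_eq_zero (e := O r c), mul_zero]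
      intro s a j hj
      refine Pi.single_eq_of_ne ?_ _
      rintro rfl
      exact hr ⟨s, a, hj⟩
  rw [Finset.sum_congr rfl fun r _ => h2 r, if_pos rfl, Finset.sum_boole] at h1
  have h3 : (∑ j, ‖(Pi.single i 1 : κ → ℂ) j‖ ^ 2 : ℝ) = 1 := by
    rw [Finset.sum_eq_single i]
    · simp
    · intro j _ hj; simp [Pi.single_eq_of_ne hj]
    · simp
  rw [h3] at h1
  have h4 : (Finset.univ.filter fun r => ∃ s a, O r c = .var s a i).card = 1 := by
    exact_mod_cast h1
  obtain ⟨r, hr⟩ := Finset.card_eq_one.1 h4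
  refine ⟨r, ?_, ?_⟩
  · have : r ∈ (Finset.univ.filter fun r => ∃ s a, O r c = .var s a i) := by
      rw [hr]; exact Finset.mem_singleton_self r
    exact (Finset.mem_filter.1 this).2
  · intro r' hr'
    have : r' ∈ (Finset.univ.filter fun r => ∃ s a, O r c = .var s a i) :=
      Finset.mem_filter.2 ⟨Finset.mem_univ _, hr'⟩
    rw [hr] at this
    exact Finset.mem_singleton.1 this

/-- The row in which the column `c` contains the variable `i`. -/
noncomputable def row (h : IsCOD O) (c : ι) (i : κ) : ρ := (h.existsUnique_row c i).choose

/-- The sign of the variable `i` in the column `c`. -/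
noncomputable def sgn (h : IsCOD O) (c : ι) (i : κ) : ℤˣ :=
  (h.existsUnique_row c i).choose_spec.1.choose

/-- Whether the variable `i` is conjugated in the column `c`. -/
noncomputable def cj (h : IsCOD O) (c : ι) (i : κ) : Bool :=
  (h.existsUnique_row c i).choose_spec.1.choose_spec.choose

theorem entry (h : IsCOD O) (c : ι) (i : κ) :
    O (h.row c i) c = .var (h.sgn c i) (h.cj c i) i :=
  (h.existsUnique_row c i).choose_spec.1.choose_spec.choose_spec

theorem eq_row (h : IsCOD O) {r : ρ} {c : ι} {s : ℤˣ} {a : Bool} {i : κ}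
    (hr : O r c = .var s a i) : r = h.row c i :=
  (h.existsUnique_row c i).choose_spec.2 r ⟨s, a, hr⟩

theorem eq_row_sgn_cj (h : IsCOD O) {r : ρ} {c : ι} {s : ℤˣ} {a : Bool} {i : κ}
    (hr : O r c = .var s a i) : r = h.row c i ∧ s = h.sgn c i ∧ a = h.cj c i := by
  have h1 := h.eq_row hr
  have h2 := h.entry c i
  rw [← h1, hr] at h2
  injection h2 with h3 h4 h5
  exact ⟨h1, h3, h4⟩

theorem row_injective (h : IsCOD O) (c : ι) : Function.Injective (h.row c) := by
  intro i j hij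
  have h1 := h.entry c i
  rw [hij, h.entry c j] at h1
  injection h1 with _ _ h2
  exact h2.symm

theorem exists_row_eq (h : IsCOD O) {r : ρ} {c : ι} (hr : O r c ≠ .zero) :
    ∃ i, h.row c i = r := by
  cases hO : O r c with
  | zero => exact absurd hO hr
  | var s a i => exact ⟨i, (h.eq_row hO).symm⟩

theorem apply_row_ne_zero (h : IsCOD O) (c : ι) (i : κ) : O (h.row c i) c ≠ .zero := by
  rw [h.entry]; exact fun h => by cases h

theorem row_ne_row (h : IsCOD O) {c c' : ι} (hc : c ≠ c') (i : κ) :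
    h.row c i ≠ h.row c' i := by
  classical
  intro hr
  have h1 := isCOD_iff.1 h (Pi.single i 1) c c'
  rw [if_neg hc, Finset.sum_eq_single (h.row c i)] at h1
  · rw [h.entry, hr, h.entry] at h1
    simp [Entry.eval] at h1
  · intro r _ hne
    rw [Entry.eval_eq_zero (e := O r c)]
    · simp
    · intro s a j hj
      refine Pi.single_eq_of_ne ?_ _
      rintro rfl
      exact hne (h.eq_row hj)
  · simp

/-- If a row contains two variables then these variables occur in a second row, with columns
interchanged, and both rows form an Alamouti block. -/
theorem alamouti (h : IsCOD O) {c c' : ι} (hc : c ≠ c') {i j : κ}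
    (hr : h.row c i = h.row c' j) :
    h.row c j = h.row c' i ∧ h.cj c' i = !h.cj c i ∧ h.cj c' j = !h.cj c j ∧
      h.sgn c i * h.sgn c' j * h.sgn c j * h.sgn c' i = -1 := by
  classical
  have hij : i ≠ j := by
    rintro rfl
    exact h.row_ne_row hc i hr
  have hrows : h.row c i ≠ h.row c j := fun hh => hij (h.row_injective c hh)
  -- With only `z_i = x` and `z_j = y` possibly nonzero, orthogonality of the two columns reduces to
  -- the two rows in which column `c` contains `z_i` or `z_j`.
  have key : ∀ x y : ℂ, ∀ z : κ → ℂ, z = (fun l => if l = i then x else if l = j then y else 0) →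
      star ((Entry.var (h.sgn c i) (h.cj c i) i).eval z) *
        (Entry.var (h.sgn c' j) (h.cj c' j) j).eval z +
      star ((Entry.var (h.sgn c j) (h.cj c j) j).eval z) * (O (h.row c j) c').eval z = 0 := by
    intro x y z hz
    have h1 := isCOD_iff.1 h z c c'
    rw [if_neg hc, Finset.sum_eq_add (h.row c i) (h.row c j) hrows] at h1
    · rwa [h.entry, h.entry, hr, h.entry] at h1
    · rintro r - ⟨hr1, hr2⟩
      rw [Entry.eval_eq_zero (e := O r c)]
      · simp
      · intro s a l hl
        have h3 := h.eq_row hl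
        have h4 : l ≠ i := by rintro rfl; exact hr1 h3
        have h5 : l ≠ j := by rintro rfl; exact hr2 h3
        simp [hz, h4, h5]
    · simp
    · simp
  have hne : O (h.row c j) c' ≠ .zero := by
    intro h0
    have h1 := key 1 1 _ rfl
    rw [h0] at h1
    simp [Entry.eval, hij.symm] at h1
  obtain ⟨l, hl⟩ := h.exists_row_eq hne
  have hle : O (h.row c j) c' = .var (h.sgn c' l) (h.cj c' l) l := by rw [← hl, h.entry]
  rw [hle] at key
  have hlj : l ≠ j := by
    rintro rfl
    exact h.row_ne_row hc l hl.symm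
  have hli : l = i := by
    by_contra hli
    have h1 := key 1 1 _ rfl
    simp [Entry.eval, hij.symm, hli, hlj] at h1
  subst hli
  refine ⟨hl.symm, ?_⟩
  -- The values `(1, 1)` determine the sign product; putting `I` for `z_i`, respectively for `z_j`,
  -- detects whether that variable is conjugated differently in the two columns.
  have h1 := key 1 1 _ rfl
  have h2 := key Complex.I 1 _ rfl
  have h3 := key 1 Complex.I _ rfl
  simp only [Entry.eval, hij.symm, if_true, if_false, star_one, ite_self, mul_one] at h1 h2 h3
  generalize h.sgn c l = s1 at *
  generalize h.sgn c' j = s2 at *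
  generalize h.sgn c j = s3 at *
  generalize h.sgn c' l = s4 at *
  generalize h.cj c l = b1 at *
  generalize h.cj c' j = b2 at *
  generalize h.cj c j = b3 at *
  generalize h.cj c' l = b4 at *
  have hs : s1 * s2 * s3 * s4 = -1 := by
    rcases Int.units_eq_one_or s1 with rfl | rfl <;> rcases Int.units_eq_one_or s2 with rfl | rfl <;>
    rcases Int.units_eq_one_or s3 with rfl | rfl <;> rcases Int.units_eq_one_or s4 with rfl | rfl <;>
    first
    | rfl
    | (exfalso; norm_num at h1)
  have hu : ((s1 : ℤ) : ℂ) * ((s2 : ℤ) : ℂ) = -(((s3 : ℤ) : ℂ) * ((s4 : ℤ) : ℂ)) := by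
    simpa [eq_neg_iff_add_eq_zero] using h1
  have hu0 : ((s3 : ℤ) : ℂ) * ((s4 : ℤ) : ℂ) ≠ 0 := by simp
  have hI : (Complex.I : ℂ) + Complex.I ≠ 0 := by
    rw [← two_mul]; simp
  refine ⟨?_, ?_, hs⟩
  · cases b1 <;> cases b4 <;> simp at h2 ⊢ <;> apply hI <;> apply mul_left_cancel₀ hu0 <;>
      first
      | linear_combination h2 - Complex.I * hu
      | linear_combination h2 + Complex.I * hu
      | linear_combination -h2 - Complex.I * hu
      | linear_combination -h2 + Complex.I * hu
  · cases b2 <;> cases b3 <;> simp at h3 ⊢ <;> apply hI <;> apply mul_left_cancel₀ hu0 <;>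
      first
      | linear_combination h3 - Complex.I * hu
      | linear_combination h3 + Complex.I * hu
      | linear_combination -h3 - Complex.I * hu
      | linear_combination -h3 + Complex.I * hu

end

/-- A matrix in which every column contains every variable exactly once and any two nonzero
entries of a row lie in an Alamouti block is a complex orthogonal design. -/
theorem of_alamouti [Fintype ρ] [DecidableEq ι] [Fintype κ] {O : Matrix ρ ι (Entry κ)}
    (hrow : ∀ c i, ∃! r, ∃ s a, O r c = .var s a i)
    (hblock : ∀ r c c' s a i s' b j, c ≠ c' → O r c = .var s a i → O r c' = .var s' b j →
      ∃ r' u u', O r' c = .var u (!b) j ∧ O r' c' = .var u' (!a) i ∧ s * s' * u * u' = -1) :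
    IsCOD O := by
  classical
  refine isCOD_iff.2 fun z c c' => ?_
  split_ifs with hc
  · subst hc
    choose R hR hR' using fun i => hrow c i
    have hinj : Function.Injective R := by
      intro i j hij
      obtain ⟨s, a, h1⟩ := hR i
      obtain ⟨s', a', h2⟩ := hR j
      rw [hij, h2] at h1
      injection h1 with _ _ h3
      exact h3.symm
    rw [← Finset.sum_subset (Finset.subset_univ (Finset.univ.image R)),
      Finset.sum_image fun i _ j _ hij => hinj hij, Complex.ofReal_sum]
    · refine Finset.sum_congr rfl fun i _ => ?_
      obtain ⟨s, a, h1⟩ := hR i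
      rw [h1, Entry.star_eval_mul_eval]
    · intro r _ hr
      rw [Entry.eval_eq_zero (e := O r c), mul_zero]
      intro s a i h1
      exact absurd (Finset.mem_image.2 ⟨i, Finset.mem_univ _, (hR' i r ⟨s, a, h1⟩).symm⟩) hr
  · have hex : ∀ r, ∃ r', (O r c = .zero ∨ O r c' = .zero) ∧ r' = r ∨
        ∃ s a i s' b j u u', O r c = .var s a i ∧ O r c' = .var s' b j ∧
          O r' c = .var u (!b) j ∧ O r' c' = .var u' (!a) i ∧ s * s' * u * u' = -1 := by
      intro r
      cases h1 : O r c with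
      | zero => exact ⟨r, .inl ⟨.inl rfl, rfl⟩⟩
      | var s a i =>
        cases h2 : O r c' with
        | zero => exact ⟨r, .inl ⟨.inr rfl, rfl⟩⟩
        | var s' b j =>
          obtain ⟨r', u, u', h3⟩ := hblock r c c' s a i s' b j hc h1 h2
          exact ⟨r', .inr ⟨s, a, i, s', b, j, u, u', rfl, rfl, h3⟩⟩
    choose g hg using hex
    -- The two rows of a block cancel. A row with a zero in one of the columns is its own partner
    -- and contributes `0`.
    refine Finset.sum_involution (fun r _ => g r) ?_ ?_ (fun _ _ => Finset.mem_univ _) ?_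
    · intro r _
      rcases hg r with ⟨h1 | h1, h2⟩ | ⟨s, a, i, s', b, j, u, u', h1, h2, h3, h4, h5⟩
      · rw [h2, h1]; simp [Entry.eval]
      · rw [h2, h1]; simp [Entry.eval]
      · simp only [h1, h2, h3, h4]
        have h6 : u * u' = -(s * s') := by
          have : u * u' = (s * s' * u * u') * (s * s') := by
            have e1 := Int.units_mul_self s
            have e2 := Int.units_mul_self s'
            calc u * u' = (s * s) * (s' * s') * (u * u') := by rw [e1, e2]; simp
              _ = _ := by ac_rfl
          rw [this, h5]; simp
        have h7 : ((u : ℤ) : ℂ) * ((u' : ℤ) : ℂ) = -(((s : ℤ) : ℂ) * ((s' : ℤ) : ℂ)) := by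
          exact_mod_cast congrArg (fun v : ℤˣ => ((v : ℤ) : ℂ)) h6
        have h8 : ∀ v w : ℂ, (s : ℤ) * v * ((s' : ℤ) * w) + (u : ℤ) * w * ((u' : ℤ) * v) = 0 :=
          fun v w => by linear_combination (v * w) * h7
        cases a <;> cases b <;> simpa [Entry.eval] using h8 _ _
    · intro r _ h0 hgr
      rcases hg r with ⟨h1 | h1, h2⟩ | ⟨s, a, i, s', b, j, u, u', h1, h2, h3, h4, h5⟩
      · exact h0 (by rw [h1]; simp [Entry.eval])
      · exact h0 (by rw [h1]; simp [Entry.eval])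
      · rw [hgr, h1] at h3
        rw [hgr, h2] at h4
        injection h3 with h6 _ _
        injection h4 with h7 _ _
        subst h6 h7
        have : s * s' * s * s' = (s * s) * (s' * s') := by ac_rfl
        rw [this, Int.units_mul_self, Int.units_mul_self] at h5
        exact absurd h5 (by decide)
    · intro r _
      rcases hg r with ⟨h1, h2⟩ | ⟨s, a, i, s', b, j, u, u', h1, h2, h3, h4, h5⟩
      · simp only [h2]
      · rcases hg (g r) with ⟨h6 | h6, h7⟩ | ⟨t, d, k, t', e, l, v, v', h6, h7, h8, h9, h10⟩
        · rw [h3] at h6; cases h6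
        · rw [h4] at h6; cases h6
        · rw [h4] at h7
          injection h7 with _ _ h7
          subst h7
          exact (hrow c i).unique ⟨_, _, h8⟩ ⟨_, _, h1⟩

end IsCOD

/-! ### Exchange of elements and potentials on levels of the cube -/

/-- A property of sets that is stable under exchanging an element passes from a set to any
other set of the same cardinality. -/
theorem exchange_induction {ι : Type*} [DecidableEq ι] {B : Finset ι} (P : Finset ι → Prop)
    (hP : ∀ A c d, A.card = B.card → c ∈ B → c ∉ A → d ∈ A → d ∉ B → P A →
      P (insert c (A.erase d)))
    {A : Finset ι} (hA : A.card = B.card) (h : P A) : P B := by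
  induction hn : (B \ A).card generalizing A with
  | zero =>
    have h1 : B ⊆ A := by simpa using hn
    rwa [Finset.eq_of_subset_of_card_le h1 hA.le]
  | succ n ih =>
    obtain ⟨c, hc⟩ : (B \ A).Nonempty := by rw [← Finset.card_pos]; omega
    obtain ⟨d, hd⟩ : (A \ B).Nonempty := by
      rw [← Finset.card_pos, ← Finset.card_sdiff_comm hA.symm]; omega
    rw [Finset.mem_sdiff] at hc hd
    have hcd : c ∉ A.erase d := fun h => hc.2 (Finset.mem_of_mem_erase h)
    refine ih (A := insert c (A.erase d)) ?_ (hP A c d hA hc.1 hc.2 hd.1 hd.2 h) ?_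
    · rw [Finset.card_insert_of_notMem hcd, Finset.card_erase_of_mem hd.1]
      have := Finset.card_pos.2 ⟨d, hd.1⟩
      omega
    · have : B \ insert c (A.erase d) = (B \ A).erase c := by
        ext x
        simp only [Finset.mem_sdiff, Finset.mem_insert, Finset.mem_erase]
        constructor
        · rintro ⟨h1, h2⟩
          refine ⟨fun h => h2 (.inl h), h1, fun h3 => h2 (.inr ⟨?_, h3⟩)⟩
          rintro rfl
          exact hd.2 h1
        · rintro ⟨h1, h2, h3⟩
          exact ⟨h2, by tauto⟩
      rw [this, Finset.card_erase_of_mem (Finset.mem_sdiff.2 hc), hn]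
      rfl

theorem mul_eq_iff_units {a b c : ℤˣ} : a * b = c ↔ a = c * b := by
  constructor
  · rintro rfl; rw [mul_assoc, Int.units_mul_self, mul_one]
  · rintro rfl; rw [mul_assoc, Int.units_mul_self, mul_one]

section Potential

variable {ι : Type*} [DecidableEq ι]

/-- A sign function on the edges of the cube of subsets that is closed on the squares with
bottom level `a` and has a potential on the edges with bottom level `a` has one on the edges
with bottom level `a` or `a + 1`. -/
theorem extend_potential (a : ℕ) (u : Finset ι → ι → ℤˣ)
    (hu : ∀ S c d, S.card = a → c ∉ S → d ∉ S → c ≠ d →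
      u S c * u (insert c S) d = u S d * u (insert d S) c)
    (f : Finset ι → ℤˣ) (hf : ∀ S c, S.card = a → c ∉ S → f (insert c S) = f S * u S c) :
    ∃ g : Finset ι → ℤˣ, ∀ S c, S.card = a ∨ S.card = a + 1 → c ∉ S →
      g (insert c S) = g S * u S c := by
  classical
  -- The value on a set of size `a + 2` is forced by any one of its elements; closedness on the
  -- squares makes it independent of that element.
  have key : ∀ T : Finset ι, ∃ v : ℤˣ, T.card = a + 2 → ∀ x ∈ T,
      v = f (T.erase x) * u (T.erase x) x := by
    intro T
    by_cases hT : T.card = a + 2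
    swap
    · exact ⟨1, fun h => absurd h hT⟩
    obtain ⟨y, hy⟩ : T.Nonempty := by rw [← Finset.card_pos]; omega
    refine ⟨f (T.erase y) * u (T.erase y) y, fun _ x hx => ?_⟩
    by_cases hxy : x = y
    · rw [hxy]
    have hx' : x ∈ T.erase y := Finset.mem_erase.2 ⟨hxy, hx⟩
    have hy' : y ∈ T.erase x := Finset.mem_erase.2 ⟨Ne.symm hxy, hy⟩
    have e1 : insert x ((T.erase x).erase y) = T.erase y := by
      rw [Finset.erase_right_comm, Finset.insert_erase hx']
    have e2 : insert y ((T.erase x).erase y) = T.erase x := Finset.insert_erase hy'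
    have hcard : ((T.erase x).erase y).card = a := by
      rw [Finset.card_erase_of_mem hy', Finset.card_erase_of_mem hx]; omega
    have hxS : x ∉ (T.erase x).erase y := by simp
    have hyS : y ∉ (T.erase x).erase y := by simp
    have h1 := hf _ x hcard hxS
    have h2 := hf _ y hcard hyS
    have h3 := hu _ x y hcard hxS hyS hxy
    rw [e1] at h1 h3
    rw [e2] at h2 h3
    rw [h1, h2, mul_assoc, mul_assoc, h3]
  choose v hv using key
  refine ⟨fun S => if S.card = a + 2 then v S else f S, fun S c hS hc => ?_⟩
  have hi := Finset.card_insert_of_notMem hc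
  rcases hS with hS | hS
  · simp only [hi, hS]
    rw [if_neg (by omega), if_neg (by omega), hf S c hS hc]
  · simp only [hi, hS]
    rw [if_pos trivial, if_neg (by omega), hv _ (by omega) c (Finset.mem_insert_self _ _),
      Finset.erase_insert hc]

/-- A sign function on the edges of the cube of subsets with bottom level `a` or `a + 1` that is
closed on the squares with bottom level `a` is a coboundary. -/
theorem exists_potential (a : ℕ) (u : Finset ι → ι → ℤˣ)
    (hu : ∀ S c d, S.card = a → c ∉ S → d ∉ S → c ≠ d →
      u S c * u (insert c S) d = u S d * u (insert d S) c) :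
    ∃ f : Finset ι → ℤˣ, ∀ S c, S.card = a ∨ S.card = a + 1 → c ∉ S →
      f (insert c S) = f S * u S c := by
  classical
  induction a generalizing u with
  | zero =>
    -- Only the empty set and singletons matter here; on a singleton the chosen element is its only
    -- one.
    refine extend_potential 0 u hu (fun S => if h : S.Nonempty then u ∅ h.choose else 1) ?_
    intro S c hS hc
    obtain rfl := Finset.card_eq_zero.1 hS
    have h1 : (insert c (∅ : Finset ι)).Nonempty := Finset.insert_nonempty _ _
    have h2 : h1.choose = c := by simpa using h1.choose_spec
    rw [dif_pos h1, h2, dif_neg (by simp), one_mul]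
  | succ a ih =>
    -- The induction needs edge signs one level lower that close the squares above a set `S` of size
    -- `a`. These squares prescribe the ratio of the new signs at `S` for `x` and `y`, namely `w S x
    -- y`. Fixing the new sign at a base point `b S` outside `S` to be `1` then determines the
    -- others. The second argument of `b` is only a fallback for `S` the whole type.
    let b : Finset ι → ι → ι := fun S c => if h : ∃ x, x ∉ S then h.choose else c
    have hb : ∀ S c, c ∉ S → b S c ∉ S := by
      intro S c hc
      have h : ∃ x, x ∉ S := ⟨c, hc⟩
      simp only [b, dif_pos h]
      exact h.choose_spec
    have hb' : ∀ S c d, c ∉ S → d ∉ S → b S c = b S d := by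
      intro S c d hc hd
      have h : ∃ x, x ∉ S := ⟨c, hc⟩
      simp only [b, dif_pos h]
    let w : Finset ι → ι → ι → ℤˣ := fun S x y => u (insert x S) y * u (insert y S) x
    have w_self : ∀ S x, w S x x = 1 := fun S x => Int.units_mul_self _
    have w_comm : ∀ S x y, w S x y = w S y x := fun S x y => mul_comm _ _
    -- The prescribed ratios are consistent: multiply the closed squares on the three upper faces of
    -- the 3-cube over `S` in directions `x`, `y`, `z`.
    have hw : ∀ S x y z, S.card = a → x ∉ S → y ∉ S → z ∉ S →
        w S x y * w S y z = w S x z := by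
      intro S x y z hS hx hy hz
      by_cases hxy : x = y
      · rw [hxy, w_self, one_mul]
      by_cases hyz : y = z
      · rw [hyz, w_self, mul_one]
      by_cases hxz : x = z
      · rw [hxz, w_comm S z y, w_self]; exact Int.units_mul_self _
      have hc : ∀ t, t ∉ S → (insert t S).card = a + 1 := fun t ht => by
        rw [Finset.card_insert_of_notMem ht, hS]
      have h1 := hu (insert x S) y z (hc x hx) (by simp [hy, Ne.symm hxy])
        (by simp [hz, Ne.symm hxz]) hyz
      have h2 := hu (insert y S) x z (hc y hy) (by simp [hx, hxy])
        (by simp [hz, Ne.symm hyz]) hxz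
      have h3 := hu (insert z S) x y (hc z hz) (by simp [hx, hxz])
        (by simp [hy, hyz]) hxy
      rw [Finset.insert_comm z x S] at h1
      rw [Finset.insert_comm z y S, Finset.insert_comm x y S] at h2
      simp only [w]
      rw [mul_eq_iff_units.1 h1, mul_eq_iff_units.1 h2, mul_eq_iff_units.1 h3]
      generalize u (insert y (insert x S)) z = b1
      generalize u (insert y S) z = a4
      generalize u (insert x S) z = a2
      generalize u (insert x (insert z S)) y = b2
      generalize u (insert y (insert z S)) x = b3
      generalize u (insert z S) y = a6
      calc _ = (b1 * b1) * (a4 * a4) * (a2 * (a6 * b3 * b2)) := by ac_rfl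
        _ = _ := by rw [Int.units_mul_self, Int.units_mul_self, one_mul, one_mul]
    obtain ⟨f, hf⟩ := ih (fun S c => if S.card = a then w S (b S c) c else u S c) (by
      intro S c d hS hc hd hcd
      simp only [hS, if_true, Finset.card_insert_of_notMem hc, Finset.card_insert_of_notMem hd]
      rw [if_neg (by omega), if_neg (by omega), hb' S c d hc hd]
      have h1 := hw S c (b S d) d hS hc (hb S d hd) hd
      rw [w_comm S c] at h1
      have h2 : w S (b S d) c = w S c d * w S (b S d) d := mul_eq_iff_units.1 h1
      rw [h2]
      simp only [w]
      have := Int.units_mul_self (u (insert c S) d)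
      calc _ = (u (insert c S) d * u (insert c S) d) * (u (insert d S) c *
            (u (insert (b S d) S) d * u (insert d S) (b S d))) := by ac_rfl
        _ = _ := by rw [this]; ac_rfl)
    refine extend_potential (a + 1) u hu f fun S c hS hc => ?_
    rw [hf S c (.inr hS) hc, if_neg (by omega)]

end Potential

/-! ### The rate bound for an odd number of columns -/

variable {ρ ι κ : Type}

open Classical in
/-- The set of the columns with a nonzero entry in the row `r`. -/
noncomputable def rowSupport [Fintype ι] (O : Matrix ρ ι (Entry κ)) (r : ρ) : Finset ι :=
  Finset.univ.filter fun c => O r c ≠ .zero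

theorem mem_rowSupport [Fintype ι] {O : Matrix ρ ι (Entry κ)} {r : ρ} {c : ι} :
    c ∈ rowSupport O r ↔ O r c ≠ .zero := by
  simp [rowSupport]

namespace IsCOD

variable [Fintype ρ] [Fintype ι] [DecidableEq ι] [Fintype κ] {O : Matrix ρ ι (Entry κ)}

/-- Double counting of the nonzero entries: within a column they correspond bijectively to the
variables. -/
theorem sum_card_rowSupport_mul (h : IsCOD O) (g : ρ → ℤ) :
    ∑ r, ((rowSupport O r).card : ℤ) * g r = ∑ i, ∑ c, g (h.row c i) := by
  classical
  have h1 : ∀ r, ((rowSupport O r).card : ℤ) * g r =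
      ∑ c, if O r c ≠ .zero then g r else 0 := by
    intro r
    rw [← Finset.sum_filter, Finset.sum_const, nsmul_eq_mul]
    rfl
  rw [Finset.sum_congr rfl fun r _ => h1 r, Finset.sum_comm, Finset.sum_comm (γ := κ)]
  refine Finset.sum_congr rfl fun c _ => ?_
  rw [← Finset.sum_filter]
  have h2 : (Finset.univ.filter fun r => O r c ≠ .zero) = Finset.univ.image (h.row c) := by
    ext r
    simp only [Finset.mem_filter, Finset.mem_univ, true_and, Finset.mem_image]
    constructor
    · exact h.exists_row_eq
    · rintro ⟨i, rfl⟩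
      exact h.apply_row_ne_zero c i
  rw [h2, Finset.sum_image fun i _ j _ hij => h.row_injective c hij]

/-- The columns in which the conjugation of the variable `i` is not that in the column `c`. -/
noncomputable def opposite (h : IsCOD O) (c : ι) (i : κ) : Finset ι :=
  Finset.univ.filter fun c' => h.cj c' i ≠ h.cj c i

/-- The number of the columns in which the variable `i` occurs with conjugation `b`. -/
noncomputable def conjCount (h : IsCOD O) (b : Bool) (i : κ) : ℕ :=
  (Finset.univ.filter fun c => h.cj c i = b).card

/-- Any further nonzero entry of the row forms an Alamouti block with `z_i`, and the block flips the
conjugation of `z_i`. -/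
theorem rowSupport_row_subset (h : IsCOD O) (c : ι) (i : κ) :
    rowSupport O (h.row c i) ⊆ insert c (h.opposite c i) := by
  intro c' hc'
  rw [Finset.mem_insert]
  by_cases hcc : c' = c
  · exact .inl hcc
  · right
    obtain ⟨j, hj⟩ := h.exists_row_eq (mem_rowSupport.1 hc')
    have h1 := (h.alamouti (Ne.symm hcc) hj.symm).2.1
    simp [opposite, h1]

theorem card_rowSupport_row_le (h : IsCOD O) (c : ι) (i : κ) :
    (rowSupport O (h.row c i)).card ≤ 1 + (h.opposite c i).card :=
  (Finset.card_le_card (h.rowSupport_row_subset c i)).trans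
    ((Finset.card_insert_le _ _).trans (add_comm _ _).le)

theorem conjCount_add (h : IsCOD O) (i : κ) :
    h.conjCount true i + h.conjCount false i = Fintype.card ι := by
  unfold conjCount
  have := Finset.card_filter_add_card_filter_not (s := (Finset.univ : Finset ι))
    (fun c => h.cj c i = true)
  simpa using this

theorem card_opposite (h : IsCOD O) (c : ι) (i : κ) :
    (h.opposite c i).card = h.conjCount (!h.cj c i) i := by
  unfold opposite conjCount
  congr 1
  ext c'
  cases h.cj c i <;> simp

theorem sum_card_opposite (h : IsCOD O) (i : κ) :
    ∑ c, (h.opposite c i).card = 2 * (h.conjCount true i * h.conjCount false i) := by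
  have h1 : ∀ c, (h.opposite c i).card =
      if h.cj c i = true then h.conjCount false i else h.conjCount true i := by
    intro c
    rw [card_opposite]
    cases h.cj c i <;> simp
  rw [Finset.sum_congr rfl fun c _ => h1 c, Finset.sum_ite, Finset.sum_const, Finset.sum_const,
    smul_eq_mul, smul_eq_mul]
  have h2 : (Finset.univ.filter fun c => ¬ h.cj c i = true).card = h.conjCount false i := by
    unfold conjCount; simp
  rw [h2]
  change h.conjCount true i * _ + _ = _
  ring

section OddColumns

variable {q : ℕ} (hn : Fintype.card ι = 2 * q + 1)

include hn

/-- Every summand on the right is nonnegative: the row weight is an integer, so it does not lie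
strictly between `q + 1` and `q + 2`; a row weight is at most one plus the number of opposite
columns; and two natural numbers with sum `2q + 1` have product at most `q (q + 1)`. The row term is
chosen so that, after double counting, its part depending on the weights cancels against the second
sum. -/
theorem defect_identity (h : IsCOD O) :
    ((q : ℤ) + 1) * (((q : ℤ) + 2) * Fintype.card ρ - (2 * q + 2) * Fintype.card κ) =
      (∑ r, (((rowSupport O r).card : ℤ) - (q + 1)) * ((rowSupport O r).card - (q + 2))) +
      ∑ i, ((∑ c, (1 + ((h.opposite c i).card : ℤ) - (rowSupport O (h.row c i)).card)) +
        2 * ((q + 1) * q - h.conjCount true i * h.conjCount false i)) := by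
  have h1 : ∀ r, (((rowSupport O r).card : ℤ) - (q + 1)) * ((rowSupport O r).card - (q + 2)) =
      (q + 1) * (q + 2) - ((rowSupport O r).card : ℤ) * (2 * q + 3 - (rowSupport O r).card) := by
    intro r; ring
  have h2 := h.sum_card_rowSupport_mul fun r => 2 * q + 3 - ((rowSupport O r).card : ℤ)
  have h3 : ∀ i, (∑ c, (1 + ((h.opposite c i).card : ℤ) - (rowSupport O (h.row c i)).card)) +
        2 * ((q + 1) * q - h.conjCount true i * h.conjCount false i) =
      (∑ c, (2 * q + 3 - ((rowSupport O (h.row c i)).card : ℤ))) - 2 * (q + 1) * (q + 1) := by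
    intro i
    have h4 : ∑ c, ((h.opposite c i).card : ℤ) =
        2 * (h.conjCount true i * h.conjCount false i) := by
      exact_mod_cast h.sum_card_opposite i
    simp only [Finset.sum_sub_distrib, Finset.sum_add_distrib, h4, Finset.sum_const,
      Finset.card_univ, hn, nsmul_eq_mul]
    push_cast
    ring
  rw [Finset.sum_congr rfl fun r _ => h1 r, Finset.sum_congr rfl fun i _ => h3 i,
    Finset.sum_sub_distrib, Finset.sum_sub_distrib, h2]
  simp only [Finset.sum_const, Finset.card_univ, nsmul_eq_mul]
  ring

omit hn in
theorem mul_pred_nonneg (x : ℤ) : 0 ≤ (x - (q + 1)) * (x - (q + 2)) := by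
  rcases le_or_gt x (q + 1) with hx | hx <;> nlinarith

theorem conjCount_mul_le (h : IsCOD O) (i : κ) :
    (0 : ℤ) ≤ 2 * ((q + 1) * q - h.conjCount true i * h.conjCount false i) := by
  have h1 : (h.conjCount true i : ℤ) + h.conjCount false i = 2 * q + 1 := by
    exact_mod_cast (h.conjCount_add i).trans hn
  have h2 := mul_pred_nonneg (q := q) (h.conjCount true i + 1)
  nlinarith

omit hn in
theorem card_opposite_nonneg (h : IsCOD O) (i : κ) (c : ι) :
    0 ≤ 1 + ((h.opposite c i).card : ℤ) - (rowSupport O (h.row c i)).card := by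
  have : ((rowSupport O (h.row c i)).card : ℤ) ≤ 1 + (h.opposite c i).card := by
    exact_mod_cast h.card_rowSupport_row_le c i
  linarith

/-- The upper bound for the rate of a design with `2 q + 1` columns. -/
theorem rate_bound (h : IsCOD O) :
    (2 * q + 2) * Fintype.card κ ≤ (q + 2) * Fintype.card ρ := by
  have h1 := h.defect_identity hn
  have h2 := Finset.sum_nonneg fun r (_ : r ∈ Finset.univ) =>
    mul_pred_nonneg (q := q) (rowSupport O r).card
  have h3 := Finset.sum_nonneg fun i (_ : i ∈ Finset.univ) => add_nonneg
    (Finset.sum_nonneg fun c (_ : c ∈ Finset.univ) => h.card_opposite_nonneg i c)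
    (h.conjCount_mul_le hn i)
  have h4 := add_nonneg h2 h3
  rw [← h1, mul_nonneg_iff_of_pos_left (by positivity)] at h4
  zify
  linarith

/-- The defect is then nonpositive, so all the nonnegative terms of `defect_identity` vanish
separately. -/
theorem of_rate_eq (h : IsCOD O) (hr : (q + 2) * Fintype.card ρ ≤ (2 * q + 2) * Fintype.card κ) :
    (∀ r, (rowSupport O r).card = q + 1 ∨ (rowSupport O r).card = q + 2) ∧
    (∀ c i, rowSupport O (h.row c i) = insert c (h.opposite c i)) ∧
    ∀ i, h.conjCount true i = q ∨ h.conjCount true i = q + 1 := by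
  have h1 := h.defect_identity hn
  have h2 := Finset.sum_nonneg fun r (_ : r ∈ Finset.univ) =>
    mul_pred_nonneg (q := q) (rowSupport O r).card
  have h3 := Finset.sum_nonneg fun i (_ : i ∈ Finset.univ) => add_nonneg
    (Finset.sum_nonneg fun c (_ : c ∈ Finset.univ) => h.card_opposite_nonneg i c)
    (h.conjCount_mul_le hn i)
  have hr' : ((q : ℤ) + 2) * Fintype.card ρ - (2 * q + 2) * Fintype.card κ ≤ 0 := by
    have : ((q : ℤ) + 2) * Fintype.card ρ ≤ (2 * q + 2) * Fintype.card κ := by exact_mod_cast hr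
    linarith
  have h4 : ((q : ℤ) + 1) * (((q : ℤ) + 2) * Fintype.card ρ - (2 * q + 2) * Fintype.card κ) ≤ 0 :=
    mul_nonpos_of_nonneg_of_nonpos (by positivity) hr'
  rw [h1] at h4
  have h5 := le_antisymm (by linarith) h2
  have h6 := le_antisymm (by linarith) h3
  rw [Finset.sum_eq_zero_iff_of_nonneg fun r _ => mul_pred_nonneg _] at h5
  rw [Finset.sum_eq_zero_iff_of_nonneg fun i _ => add_nonneg
    (Finset.sum_nonneg fun c _ => h.card_opposite_nonneg i c) (h.conjCount_mul_le hn i)] at h6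
  refine ⟨fun r => ?_, fun c i => ?_, fun i => ?_⟩
  · rcases mul_eq_zero.1 (h5 r (Finset.mem_univ _)) with h7 | h7
    · left; zify; linarith
    · right; zify; linarith
  · have h7 := h6 i (Finset.mem_univ _)
    have h8 := Finset.sum_nonneg fun c (_ : c ∈ Finset.univ) => h.card_opposite_nonneg i c
    have h9 := h.conjCount_mul_le hn i
    have h10 := le_antisymm (by linarith) h8
    rw [Finset.sum_eq_zero_iff_of_nonneg fun c _ => h.card_opposite_nonneg i c] at h10
    have h11 := h10 c (Finset.mem_univ _)
    refine Finset.eq_of_subset_of_card_le (h.rowSupport_row_subset c i)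
      ((Finset.card_insert_le _ _).trans ?_)
    zify
    linarith
  · have h7 := h6 i (Finset.mem_univ _)
    have h8 := Finset.sum_nonneg fun c (_ : c ∈ Finset.univ) => h.card_opposite_nonneg i c
    have h9 := h.conjCount_mul_le hn i
    have h1 : (h.conjCount false i : ℤ) = 2 * q + 1 - h.conjCount true i := by
      have : (h.conjCount true i : ℤ) + h.conjCount false i = 2 * q + 1 := by
        exact_mod_cast (h.conjCount_add i).trans hn
      linarith
    have h10 : ((h.conjCount true i : ℤ) - q) * (h.conjCount true i - (q + 1)) = 0 := by
      rw [h1] at h7 h9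
      nlinarith
    rcases mul_eq_zero.1 h10 with h11 | h11
    · left; zify; linarith
    · right; zify; linarith

end OddColumns

end IsCOD

/-! ### Designs attaining the rate bound and their uniqueness -/

variable {ρ ι κ ρ' κ' : Type}

namespace Entry

/-- Multiplication of an entry by a sign, together with sign changes and conjugations of
variables. -/
def twist (g : ℤˣ) (x : κ → ℤˣ) (t : κ → Bool) : Entry κ → Entry κ
  | zero => zero
  | var s b i => var (g * x i * s) (xor (t i) b) i

end Entry

/-- Two designs are the same up to labelling, negation of rows, columns and variables, and
conjugation of variables. -/
def SignEquivalent (O : Matrix ρ ι (Entry κ)) (O' : Matrix ρ' ι (Entry κ')) : Prop :=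
  ∃ (a : ρ ≃ ρ') (f : κ ≃ κ') (y : ρ → ℤˣ) (w : ι → ℤˣ) (x : κ → ℤˣ) (t : κ → Bool),
    ∀ r c, O' (a r) c = ((O r c).twist (y r * w c) x t).rename f

namespace IsCOD

section Tight

variable [Fintype ρ] [Fintype ι] [DecidableEq ι] [Fintype κ] {O : Matrix ρ ι (Entry κ)}

/-- The conjugation type that the variable `i` has in exactly `q + 1` of `2 * q + 1` columns. -/
noncomputable def majorConj (q : ℕ) (h : IsCOD O) (i : κ) : Bool :=
  decide (h.conjCount true i = q + 1)

/-- The set of the columns in which the variable `i` has its more frequent conjugation type. -/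
noncomputable def label (q : ℕ) (h : IsCOD O) (i : κ) : Finset ι :=
  Finset.univ.filter fun c => h.cj c i = h.majorConj q i

theorem mem_label {q : ℕ} {h : IsCOD O} {i : κ} {c : ι} :
    c ∈ h.label q i ↔ h.cj c i = h.majorConj q i := by
  simp [label]

/-- The support of a row of weight `q + 2`, and the complement of the support of any other row. -/
noncomputable def rowLabel (q : ℕ) (O : Matrix ρ ι (Entry κ)) (r : ρ) : Finset ι :=
  if (rowSupport O r).card = q + 2 then rowSupport O r else (rowSupport O r)ᶜ

variable {q : ℕ} (hn : Fintype.card ι = 2 * q + 1) (h : IsCOD O)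
  (hr : (q + 2) * Fintype.card ρ ≤ (2 * q + 2) * Fintype.card κ)

include hn h hr

theorem card_label (i : κ) : (h.label q i).card = q + 1 := by
  change h.conjCount (h.majorConj q i) i = q + 1
  unfold majorConj
  have h1 := h.conjCount_add i
  rw [hn] at h1
  rcases (h.of_rate_eq hn hr).2.2 i with h2 | h2
  · rw [decide_eq_false (by omega)]; omega
  · rw [decide_eq_true h2, h2]

theorem rowSupport_row_of_notMem {c : ι} {i : κ} (hc : c ∉ h.label q i) :
    rowSupport O (h.row c i) = insert c (h.label q i) := by
  rw [(h.of_rate_eq hn hr).2.1 c i]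
  congr 1
  ext c'
  rw [mem_label] at hc ⊢
  simp only [opposite, Finset.mem_filter, Finset.mem_univ, true_and]
  revert hc
  cases h.cj c i <;> cases h.cj c' i <;> cases h.majorConj q i <;> decide

theorem rowSupport_row_of_mem {c : ι} {i : κ} (hc : c ∈ h.label q i) :
    rowSupport O (h.row c i) = insert c (h.label q i)ᶜ := by
  rw [(h.of_rate_eq hn hr).2.1 c i]
  congr 1
  ext c'
  rw [mem_label] at hc
  rw [Finset.mem_compl, mem_label]
  simp only [opposite, Finset.mem_filter, Finset.mem_univ, true_and, hc, ne_eq]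

theorem rowLabel_row_of_notMem {c : ι} {i : κ} (hc : c ∉ h.label q i) :
    rowLabel q O (h.row c i) = insert c (h.label q i) := by
  unfold rowLabel
  rw [h.rowSupport_row_of_notMem hn hr hc, if_pos]
  rw [Finset.card_insert_of_notMem hc, h.card_label hn hr]

theorem rowLabel_row_of_mem {c : ι} {i : κ} (hc : c ∈ h.label q i) :
    rowLabel q O (h.row c i) = (h.label q i).erase c := by
  unfold rowLabel
  rw [h.rowSupport_row_of_mem hn hr hc, if_neg]
  · ext x
    simp only [Finset.mem_compl, Finset.mem_insert, Finset.mem_erase]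
    tauto
  · rw [Finset.card_insert_of_notMem (by simpa using hc), Finset.card_compl,
      h.card_label hn hr, hn]
    omega

/-- This places the design on the cube: variables are vertices of level `q + 1`, rows are vertices
of levels `q` and `q + 2`, and a nonzero entry in column `c` is an edge in direction `c`. -/
theorem rowLabel_row (c : ι) (i : κ) : rowLabel q O (h.row c i) = h.label q i ∆ {c} := by
  by_cases hc : c ∈ h.label q i
  · rw [h.rowLabel_row_of_mem hn hr hc]
    ext x
    simp only [Finset.mem_symmDiff, Finset.mem_erase, Finset.mem_singleton]
    grind
  · rw [h.rowLabel_row_of_notMem hn hr hc]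
    ext x
    simp only [Finset.mem_symmDiff, Finset.mem_insert, Finset.mem_singleton]
    grind

theorem rowSupport_eq (r : ρ) : rowSupport O r =
    if (rowLabel q O r).card = q + 2 then rowLabel q O r else (rowLabel q O r)ᶜ := by
  unfold rowLabel
  rcases (h.of_rate_eq hn hr).1 r with h1 | h1
  · have h2 : ¬ (rowSupport O r).card = q + 2 := by omega
    have h3 : ¬ (rowSupport O r)ᶜ.card = q + 2 := by rw [Finset.card_compl, h1, hn]; omega
    simp only [if_neg h2, if_neg h3, compl_compl]
  · rw [if_pos h1, if_pos h1]

theorem exists_eq_row (r : ρ) : ∃ c i, h.row c i = r := by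
  have h1 : (rowSupport O r).Nonempty := by
    rw [← Finset.card_pos]
    rcases (h.of_rate_eq hn hr).1 r with h1 | h1 <;> omega
  obtain ⟨c, hc⟩ := h1
  exact ⟨c, h.exists_row_eq (mem_rowSupport.1 hc)⟩

/-- Every set of `q + 1` columns is the label of a variable. -/
theorem exists_label_eq (hκ : 0 < Fintype.card κ) {B : Finset ι} (hB : B.card = q + 1) :
    ∃ i, h.label q i = B := by
  obtain ⟨i⟩ := Fintype.card_pos_iff.1 hκ
  refine exchange_induction (B := B) (fun A => ∃ i, h.label q i = A) ?_
    (A := h.label q i) (by rw [hB, h.card_label hn hr]) ⟨i, rfl⟩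
  rintro A c d hA - hc hd - ⟨i, rfl⟩
  have hcd : c ≠ d := by rintro rfl; exact hc hd
  -- Going up in direction `c` to a row and down again in direction `d` reaches a variable whose
  -- label has `d` exchanged for `c`.
  have h1 : d ∈ rowSupport O (h.row c i) := by
    rw [h.rowSupport_row_of_notMem hn hr hc]
    exact Finset.mem_insert_of_mem hd
  obtain ⟨j, hj⟩ := h.exists_row_eq (mem_rowSupport.1 h1)
  refine ⟨j, ?_⟩
  have h2 := h.rowLabel_row_of_notMem hn hr hc
  rw [← hj, h.rowLabel_row hn hr] at h2
  rw [← symmDiff_symmDiff_cancel_right {d} (h.label q j), h2]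
  ext x
  simp only [Finset.mem_symmDiff, Finset.mem_insert, Finset.mem_singleton, Finset.mem_erase]
  grind

theorem choose_le_card (hκ : 0 < Fintype.card κ) : (2 * q + 1).choose q ≤ Fintype.card κ := by
  have h1 : Finset.powersetCard (q + 1) Finset.univ ⊆ Finset.univ.image (h.label q) := by
    intro B hB
    obtain ⟨i, hi⟩ := h.exists_label_eq hn hr hκ (Finset.mem_powersetCard.1 hB).2
    exact Finset.mem_image.2 ⟨i, Finset.mem_univ _, hi⟩
  have h2 := (Finset.card_le_card h1).trans Finset.card_image_le
  rw [Finset.card_powersetCard, Finset.card_univ, Finset.card_univ, hn] at h2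
  rwa [Nat.choose_symm_of_eq_add (show 2 * q + 1 = q + (q + 1) by omega)]

theorem label_injective (hκ : Fintype.card κ = (2 * q + 1).choose q) :
    Function.Injective (h.label q) := by
  have h0 : 0 < Fintype.card κ := by rw [hκ]; exact Nat.choose_pos (by omega)
  have h1 : Finset.powersetCard (q + 1) Finset.univ ⊆ Finset.univ.image (h.label q) := by
    intro B hB
    obtain ⟨i, hi⟩ := h.exists_label_eq hn hr h0 (Finset.mem_powersetCard.1 hB).2
    exact Finset.mem_image.2 ⟨i, Finset.mem_univ _, hi⟩
  have h2 := Finset.card_le_card h1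
  rw [Finset.card_powersetCard, Finset.card_univ, hn,
    ← Nat.choose_symm_of_eq_add (show 2 * q + 1 = q + (q + 1) by omega), ← hκ] at h2
  have h3 := Finset.card_image_iff.1 (le_antisymm Finset.card_image_le h2)
  exact fun i j hij => h3 (by simp) (by simp) hij

/-- The label determines the support. In a common column of the supports, rows with equal labels
contain variables with equal labels, hence the same variable, which occurs only once in that column.
-/
theorem rowLabel_injective (hκ : Fintype.card κ = (2 * q + 1).choose q) :
    Function.Injective (rowLabel q O) := by
  intro r r' hrr
  obtain ⟨c, i, rfl⟩ := h.exists_eq_row hn hr r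
  have h1 : c ∈ rowSupport O r' := by
    rw [h.rowSupport_eq hn hr, ← hrr, ← h.rowSupport_eq hn hr]
    exact mem_rowSupport.2 (h.apply_row_ne_zero c i)
  obtain ⟨j, rfl⟩ := h.exists_row_eq (mem_rowSupport.1 h1)
  rw [h.rowLabel_row hn hr, h.rowLabel_row hn hr] at hrr
  rw [h.label_injective hn hr hκ (symmDiff_left_injective _ hrr)]

end Tight

theorem exists_equiv_of_injective {α β γ : Type} {F : α → γ} {F' : β → γ}
    (hF : Function.Injective F) (hF' : Function.Injective F') (h : ∀ x, ∃ y, F' y = F x)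
    (h' : ∀ y, ∃ x, F x = F' y) : ∃ e : α ≃ β, ∀ x, F' (e x) = F x := by
  choose g hg using h
  choose g' hg' using h'
  exact ⟨⟨g, g', fun x => hF (by rw [hg', hg]), fun y => hF' (by rw [hg, hg'])⟩, hg⟩

/-- Two designs with `2 q + 1` columns, the largest possible rate and the smallest possible
number of variables are the same up to signs and conjugations. -/
theorem signEquivalent [Fintype ρ] [Fintype ι] [DecidableEq ι] [Fintype κ] [Fintype ρ']
    [Fintype κ'] {O : Matrix ρ ι (Entry κ)} {O' : Matrix ρ' ι (Entry κ')} {q : ℕ}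
    (hn : Fintype.card ι = 2 * q + 1) (h : IsCOD O) (h' : IsCOD O')
    (hr : (q + 2) * Fintype.card ρ ≤ (2 * q + 2) * Fintype.card κ)
    (hr' : (q + 2) * Fintype.card ρ' ≤ (2 * q + 2) * Fintype.card κ')
    (hκ : Fintype.card κ = (2 * q + 1).choose q) (hκ' : Fintype.card κ' = (2 * q + 1).choose q) :
    SignEquivalent O O' := by
  classical
  have hpos : 0 < (2 * q + 1).choose q := Nat.choose_pos (by omega)
  obtain ⟨f, hf⟩ := exists_equiv_of_injective (h.label_injective hn hr hκ)
    (h'.label_injective hn hr' hκ')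
    (fun i => h'.exists_label_eq hn hr' (hκ' ▸ hpos) (h.card_label hn hr i))
    (fun i => h.exists_label_eq hn hr (hκ ▸ hpos) (h'.card_label hn hr' i))
  have hrow : ∀ c i, rowLabel q O' (h'.row c (f i)) = rowLabel q O (h.row c i) := by
    intro c i
    rw [h.rowLabel_row hn hr, h'.rowLabel_row hn hr', hf]
  obtain ⟨a, ha⟩ := exists_equiv_of_injective (h.rowLabel_injective hn hr hκ)
    (h'.rowLabel_injective hn hr' hκ')
    (fun r => by
      obtain ⟨c, i, rfl⟩ := h.exists_eq_row hn hr r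
      exact ⟨_, hrow c i⟩)
    (fun r => by
      obtain ⟨c, i, rfl⟩ := h'.exists_eq_row hn hr' r
      refine ⟨h.row c (f.symm i), ?_⟩
      rw [← hrow, f.apply_symm_apply])
  have harow : ∀ c i, a (h.row c i) = h'.row c (f i) := fun c i =>
    h'.rowLabel_injective hn hr' hκ' (by rw [ha, hrow])
  -- The ratio of the signs of the two designs, indexed by the variable's label and the column; the
  -- default `1` is never used on sets of size `q + 1`.
  let σ : Finset ι → ι → ℤˣ := fun A c =>
    if hA : ∃ i, h.label q i = A then h.sgn c hA.choose * h'.sgn c (f hA.choose) else 1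
  have hσ : ∀ c i, σ (h.label q i) c = h.sgn c i * h'.sgn c (f i) := by
    intro c i
    have hA : ∃ j, h.label q j = h.label q i := ⟨i, rfl⟩
    simp only [σ, dif_pos hA]
    rw [h.label_injective hn hr hκ hA.choose_spec]
  -- An edge is indexed by its lower end, which is the variable on level `q + 1` and the row on
  -- level `q`. A square with bottom level `q` is an Alamouti block; its sign product is `-1` in
  -- both designs, so the ratio is closed.
  obtain ⟨H, hH⟩ := exists_potential q
    (fun S c => if S.card = q + 1 then σ S c else σ (insert c S) c) (by
      intro S c d hS hc hd hcd
      have hSc : (insert c S).card = q + 1 := by rw [Finset.card_insert_of_notMem hc, hS]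
      have hSd : (insert d S).card = q + 1 := by rw [Finset.card_insert_of_notMem hd, hS]
      have hSq : ¬ S.card = q + 1 := by omega
      simp only [hSc, hSd, hSq, if_true, if_false]
      obtain ⟨i, hi⟩ := h.exists_label_eq hn hr (hκ ▸ hpos) hSc
      obtain ⟨j, hj⟩ := h.exists_label_eq hn hr (hκ ▸ hpos) hSd
      have hdi : d ∉ h.label q i := by rw [hi]; simp [hd, Ne.symm hcd]
      have hcj : c ∉ h.label q j := by rw [hj]; simp [hc, hcd]
      have hij : h.row d i = h.row c j := by
        apply h.rowLabel_injective hn hr hκ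
        rw [h.rowLabel_row_of_notMem hn hr hdi, h.rowLabel_row_of_notMem hn hr hcj, hi, hj,
          Finset.insert_comm]
      have hij' : h'.row d (f i) = h'.row c (f j) := by rw [← harow, hij, harow]
      have e1 := (h.alamouti (Ne.symm hcd) hij).2.2.2
      have e2 := (h'.alamouti (Ne.symm hcd) hij').2.2.2
      rw [← hi, ← hj, hσ, hσ, hσ, hσ]
      have e3 : (h.sgn c i * h'.sgn c (f i) * (h.sgn d i * h'.sgn d (f i))) *
          (h.sgn d j * h'.sgn d (f j) * (h.sgn c j * h'.sgn c (f j))) = 1 := by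
        calc _ = (h.sgn d i * h.sgn c j * h.sgn d j * h.sgn c i) *
              (h'.sgn d (f i) * h'.sgn c (f j) * h'.sgn d (f j) * h'.sgn c (f i)) := by ac_rfl
          _ = 1 := by rw [e1, e2]; rfl
      rw [mul_eq_iff_units.1 e3, one_mul])
  have hsgn : ∀ c i, h'.sgn c (f i) = H (rowLabel q O (h.row c i)) * H (h.label q i) *
      h.sgn c i := by
    intro c i
    have h1 : σ (h.label q i) c = H (rowLabel q O (h.row c i)) * H (h.label q i) := by
      by_cases hc : c ∈ h.label q i
      · rw [h.rowLabel_row_of_mem hn hr hc]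
        have hcard : ((h.label q i).erase c).card = q := by
          rw [Finset.card_erase_of_mem hc, h.card_label hn hr]; rfl
        have h2 := hH ((h.label q i).erase c) c (.inl hcard) (Finset.notMem_erase _ _)
        rw [hcard, if_neg (by omega), Finset.insert_erase hc] at h2
        rw [h2, ← mul_assoc, Int.units_mul_self, one_mul]
      · rw [h.rowLabel_row_of_notMem hn hr hc]
        have h2 := hH (h.label q i) c (.inr (h.card_label hn hr i)) hc
        rw [if_pos (h.card_label hn hr i)] at h2
        rw [h2, mul_right_comm, Int.units_mul_self, one_mul]
    rw [← h1, hσ, mul_right_comm, Int.units_mul_self, one_mul]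
  -- The potential at row vertices gives row negations, at variable vertices variable negations; no
  -- column negation is needed.
  refine ⟨a, f, fun r => H (rowLabel q O r), 1, fun i => H (h.label q i),
    fun i => xor (h.majorConj q i) (h'.majorConj q (f i)), fun r c => ?_⟩
  by_cases hc : O r c = .zero
  · rw [hc]
    have h1 : c ∉ rowSupport O' (a r) := by
      rw [h'.rowSupport_eq hn hr', ha, ← h.rowSupport_eq hn hr, mem_rowSupport]
      exact fun hne => hne hc
    rw [mem_rowSupport, not_not] at h1
    exact h1
  · obtain ⟨i, rfl⟩ := h.exists_row_eq hc
    rw [harow, h'.entry, h.entry, hsgn]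
    have h1 : h'.cj c (f i) = h'.majorConj q (f i) ↔ h.cj c i = h.majorConj q i := by
      rw [← mem_label, ← mem_label, hf]
    have h2 : h'.cj c (f i) = xor (xor (h.majorConj q i) (h'.majorConj q (f i))) (h.cj c i) := by
      revert h1
      cases h'.cj c (f i) <;> cases h'.majorConj q (f i) <;> cases h.cj c i <;>
        cases h.majorConj q i <;> decide
    rw [h2]
    simp only [Entry.twist, Entry.rename, Pi.one_apply, mul_one]

end IsCOD

/-! ### The designs `G` and `(G, L)` -/

section Partner

variable {ι : Type} [Fintype ι] [DecidableEq ι]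

/-- The support of the second row of the Alamouti block in the row `α` and the columns `c`, `d`. -/
def partner (α : Finset ι) (c d : ι) : Finset ι := αᶜ ∪ {c, d}

theorem mem_partner {α : Finset ι} {c d x : ι} : x ∈ partner α c d ↔ x ∉ α ∨ x = c ∨ x = d := by
  simp only [partner, Finset.mem_union, Finset.mem_compl, Finset.mem_insert, Finset.mem_singleton]

theorem partner_comm (α : Finset ι) (c d : ι) : partner α c d = partner α d c := by
  ext x; simp only [mem_partner]; tauto

theorem erase_partner {α : Finset ι} {c d : ι} (hc : c ∈ α) (hcd : c ≠ d) :
    (partner α c d).erase c = (α.erase d)ᶜ := by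
  ext x
  simp only [mem_partner, Finset.mem_erase, Finset.mem_compl]
  grind

theorem union_partner (α : Finset ι) (c d : ι) : α ∪ partner α c d = Finset.univ := by
  ext x
  simp only [mem_partner, Finset.mem_union, Finset.mem_univ, iff_true]
  tauto

theorem inter_partner {α : Finset ι} {c d : ι} (hc : c ∈ α) (hd : d ∈ α) :
    α ∩ partner α c d = {c, d} := by
  ext x
  simp only [mem_partner, Finset.mem_inter, Finset.mem_insert, Finset.mem_singleton]
  grind

theorem card_add_card_partner {α : Finset ι} {c d : ι} (hc : c ∈ α) (hd : d ∈ α) (hcd : c ≠ d) :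
    α.card + (partner α c d).card = Fintype.card ι + 2 := by
  rw [← Finset.card_union_add_card_inter, union_partner, inter_partner hc hd,
    Finset.card_pair hcd, Finset.card_univ]

end Partner

variable {q : ℕ}

/-- A row and its partner cover all bits and overlap in `c`, `d` only, so their numbers of bits from
`i` on add up to that of the whole set plus that of `{c, d}`. The terms `i / 2` occur twice and drop
out modulo `2`. -/
theorem even_theta_add_theta {α : Finset (Fin (2 * q + 2))} {c d : Fin (2 * q + 2)}
    (hc : c ∈ α) (hd : d ∈ α) (i : Fin (2 * q + 2)) :
    Even (theta α i + theta (partner α c d) i + i.val +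
      (({c, d} : Finset (Fin (2 * q + 2))).filter fun t => i ≤ t).card +
      if Even (i.val + 1) then 0 else (if Fin.last (2 * q + 1) ∈ α then 1 else 0) +
        (if Fin.last (2 * q + 1) ∈ partner α c d then 1 else 0)) := by
  have h1 := Finset.card_union_add_card_inter (α.filter fun t => i ≤ t)
    ((partner α c d).filter fun t => i ≤ t)
  rw [← Finset.filter_union, ← Finset.filter_inter_distrib, union_partner, inter_partner hc hd]
    at h1
  have h2 : (Finset.univ.filter fun t : Fin (2 * q + 2) => i ≤ t).card = 2 * q + 2 - i.val := by
    rw [← Fin.card_Ici]; congr 1; ext; simp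
  rw [h2] at h1
  have h3 := i.isLt
  unfold theta
  generalize (α.filter fun t => i ≤ t).card = x1 at *
  generalize ((partner α c d).filter fun t => i ≤ t).card = x2 at *
  generalize (({c, d} : Finset (Fin (2 * q + 2))).filter fun t => i ≤ t).card = x3 at *
  generalize (if Fin.last (2 * q + 1) ∈ α then 1 else 0) = x4 at *
  generalize (if Fin.last (2 * q + 1) ∈ partner α c d then 1 else 0) = x5 at *
  split_ifs
  · exact ⟨q + 1 + x3 + (i.val + 1) / 2, by omega⟩
  · exact ⟨q + 1 + x3 + i.val / 2 + x4 + x5, by omega⟩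

/-- Exactly one of the two rows contains the last bit, so columns `c` and `d` each contribute an odd
number apart from the tails of `{c, d}`, which have sizes `1` and `2`. The total is odd. -/
theorem odd_theta_block {α : Finset (Fin (2 * q + 2))} {c d : Fin (2 * q + 2)}
    (hc : c ∈ α) (hd : d ∈ α) (hcd : c ≠ d) (hcl : c ≠ Fin.last _) (hdl : d ≠ Fin.last _) :
    Odd (theta α c + theta α d + theta (partner α c d) c + theta (partner α c d) d) := by
  have h1 := even_theta_add_theta hc hd c
  have h2 := even_theta_add_theta hc hd d
  have h3 : (if Fin.last (2 * q + 1) ∈ α then 1 else 0) +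
        (if Fin.last (2 * q + 1) ∈ partner α c d then 1 else 0) = 1 := by
    simp only [mem_partner]
    split_ifs <;> grind
  rw [h3] at h1 h2
  have h4 : (({c, d} : Finset (Fin (2 * q + 2))).filter fun t => c ≤ t).card +
      (({c, d} : Finset (Fin (2 * q + 2))).filter fun t => d ≤ t).card = 3 := by
    rcases lt_or_gt_of_ne hcd with h | h
    · simp [Finset.filter_insert, Finset.filter_singleton, h.le, not_le.2 h, hcd]
    · simp [Finset.filter_insert, Finset.filter_singleton, h.le, not_le.2 h, hcd]
  simp only [Nat.even_iff, Nat.odd_iff] at *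
  split_ifs at h1 h2 <;> omega

/-- Here both rows contain the last bit and the tail of `{c, last}` has size `2`, so only the parity
of `c` remains. It prescribes the signs of an additional column. -/
theorem even_theta_block_last {α : Finset (Fin (2 * q + 2))} {c : Fin (2 * q + 2)}
    (hc : c ∈ α) (hl : Fin.last _ ∈ α) (hcl : c ≠ Fin.last _) :
    Even (theta α c + theta (partner α c (Fin.last _)) c + c.val) := by
  have h1 := even_theta_add_theta hc hl c
  have hp : Fin.last _ ∈ partner α c (Fin.last _) := mem_partner.2 (.inr (.inr rfl))
  rw [if_pos hl, if_pos hp] at h1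
  have h4 : (({c, Fin.last _} : Finset (Fin (2 * q + 2))).filter fun t => c ≤ t).card = 2 := by
    simp [Finset.filter_insert, Finset.filter_singleton, Fin.le_last, hcl]
  simp only [Nat.even_iff] at *
  split_ifs at h1 <;> omega

theorem G_eq_var_iff {α : GRow q} {c : Fin (2 * q + 1)} {s : ℤˣ} {b : Bool} {γ : GVar q} :
    G q α c = .var s b γ ↔ c.castSucc ∈ α.1 ∧ s = (-1) ^ theta α.1 c.castSucc ∧
      b = decide (Fin.last _ ∈ α.1) ∧
      γ.1 = if Fin.last _ ∈ α.1 then (α.1.erase c.castSucc)ᶜ else α.1.erase c.castSucc := by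
  simp only [G, Matrix.of_apply]
  split_ifs with h1 h2
  · simp only [Entry.var.injEq, h1, h2, true_and, decide_true, Subtype.ext_iff,
      eq_comm (a := s), eq_comm (a := b), eq_comm (a := γ.1)]
  · simp only [Entry.var.injEq, h1, h2, true_and, decide_false, Subtype.ext_iff,
      eq_comm (a := s), eq_comm (a := b), eq_comm (a := γ.1)]
  all_goals simp [h1]

theorem extraColumn_eq_var_iff {φ : GRow q → ZMod 2} {α : GRow q} {s : ℤˣ} {b : Bool}
    {γ : GVar q} :
    extraColumn q φ α = .var s b γ ↔ Fin.last _ ∈ α.1 ∧ s = (-1) ^ (φ α).val ∧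
      b = false ∧ γ.1 = α.1.erase (Fin.last _) := by
  simp only [extraColumn]
  split_ifs with h1
  · simp only [Entry.var.injEq, h1, true_and, Subtype.ext_iff,
      eq_comm (a := s), eq_comm (a := b), eq_comm (a := γ.1)]
  · simp [h1]

@[simp] theorem appendColumn_castSucc (L : GRow q → Entry (GVar q)) (α : GRow q)
    (c : Fin (2 * q + 1)) : appendColumn q L α c.castSucc = G q α c := by
  simp [appendColumn]

@[simp] theorem appendColumn_last (L : GRow q → Entry (GVar q)) (α : GRow q) :
    appendColumn q L α (Fin.last _) = L α := by
  simp [appendColumn]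

theorem G_existsUnique_row (c : Fin (2 * q + 1)) (γ : GVar q) :
    ∃! α, ∃ s b, G q α c = .var s b γ := by
  simp only [G_eq_var_iff]
  have hl := γ.2.2
  have hcl : c.castSucc ≠ Fin.last _ := (Fin.castSucc_lt_last c).ne
  -- A variable whose label contains `c` sits in a row with last bit `1`, obtained by complementing;
  -- any other sits in a row with last bit `0`.
  by_cases hc : c.castSucc ∈ γ.1
  · refine ⟨⟨(γ.1.erase c.castSucc)ᶜ, ?_⟩, ?_, ?_⟩
    · rw [Finset.card_compl, Finset.card_erase_of_mem hc, γ.2.1, Fintype.card_fin]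
      omega
    · refine ⟨_, _, by simp, rfl, rfl, ?_⟩
      rw [if_pos (by simp [hl])]
      ext x
      simp only [Finset.mem_compl, Finset.mem_erase]
      grind
    · rintro α ⟨s, b, h1, -, -, h2⟩
      apply Subtype.ext
      split_ifs at h2 with h3
      · ext x
        simp only [h2, Finset.mem_compl, Finset.mem_erase]
        grind
      · rw [h2] at hc
        simp at hc
  · refine ⟨⟨insert c.castSucc γ.1, ?_⟩, ?_, ?_⟩
    · rw [Finset.card_insert_of_notMem hc, γ.2.1]
    · refine ⟨_, _, by simp, rfl, rfl, ?_⟩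
      rw [if_neg (by simp [hl, hcl.symm]), Finset.erase_insert hc]
    · rintro α ⟨s, b, h1, -, -, h2⟩
      apply Subtype.ext
      split_ifs at h2 with h3
      · rw [h2] at hc
        simp at hc
      · simp only [h2, Finset.insert_erase h1]

/-- The second row of an Alamouti block of `G`. -/
def partnerRow (α : GRow q) {c d : Fin (2 * q + 2)} (hc : c ∈ α.1) (hd : d ∈ α.1) (hcd : c ≠ d) :
    GRow q :=
  ⟨partner α.1 c d, by
    have h1 := card_add_card_partner hc hd hcd
    rw [α.2, Fintype.card_fin] at h1
    omega⟩

theorem units_neg_one_pow_mul {a b c d : ℕ} (h : Odd (a + b + c + d)) :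
    (-1 : ℤˣ) ^ a * (-1) ^ b * (-1) ^ c * (-1) ^ d = -1 := by
  rw [← pow_add, ← pow_add, ← pow_add, h.neg_one_pow]

theorem G_block (α : GRow q) (c d : Fin (2 * q + 1)) (s : ℤˣ) (a : Bool) (i : GVar q)
    (s' : ℤˣ) (b : Bool) (j : GVar q) (hcd : c ≠ d) (h1 : G q α c = .var s a i)
    (h2 : G q α d = .var s' b j) : ∃ α' u u', G q α' c = .var u (!b) j ∧
      G q α' d = .var u' (!a) i ∧ s * s' * u * u' = -1 := by
  simp only [G_eq_var_iff] at *
  obtain ⟨hc, rfl, rfl, hi⟩ := h1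
  obtain ⟨hd, rfl, rfl, hj⟩ := h2
  have hcl : c.castSucc ≠ Fin.last _ := (Fin.castSucc_lt_last c).ne
  have hdl : d.castSucc ≠ Fin.last _ := (Fin.castSucc_lt_last d).ne
  have hcd' : c.castSucc ≠ d.castSucc := fun h => hcd (Fin.castSucc_injective _ h)
  have hlast : Fin.last _ ∈ partner α.1 c.castSucc d.castSucc ↔ Fin.last _ ∉ α.1 := by
    rw [mem_partner]
    grind
  refine ⟨partnerRow α hc hd hcd', _, _, ⟨?_, rfl, ?_, ?_⟩, ⟨?_, rfl, ?_, ?_⟩, ?_⟩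
  · simp [partnerRow, mem_partner]
  · simp [partnerRow, hlast]
  · simp only [partnerRow, hlast, erase_partner hc hcd', hj, compl_compl]
    split_ifs <;> simp_all
  · simp [partnerRow, mem_partner]
  · simp [partnerRow, hlast]
  · rw [partner_comm] at hlast
    simp only [partnerRow, partner_comm α.1 c.castSucc, hlast, erase_partner hd hcd'.symm, hi,
      compl_compl]
    split_ifs <;> simp_all
  · exact units_neg_one_pow_mul (odd_theta_block hc hd hcd' hcl hdl)

theorem isCOD_G (q : ℕ) : IsCOD (G q) :=
  IsCOD.of_alamouti G_existsUnique_row G_block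

/-- The row in which `extraColumn` contains the variable `γ`. -/
def extraRow (γ : GVar q) : GRow q :=
  ⟨insert (Fin.last _) γ.1, by rw [Finset.card_insert_of_notMem γ.2.2, γ.2.1]⟩

theorem extraColumn_existsUnique_row (φ : GRow q → ZMod 2) (γ : GVar q) :
    ∃! α, ∃ s b, extraColumn q φ α = .var s b γ := by
  simp only [extraColumn_eq_var_iff]
  refine ⟨extraRow γ, ⟨_, _, by simp [extraRow], rfl, rfl, ?_⟩, ?_⟩
  · simp only [extraRow, Finset.erase_insert γ.2.2]
  · rintro α ⟨s, b, h1, -, -, h2⟩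
    apply Subtype.ext
    simp only [extraRow, h2, Finset.insert_erase h1]

theorem extraColumn_block {φ : GRow q → ZMod 2}
    (hφ : ∀ (α : GRow q) (c : Fin (2 * q + 2)) (hc : c ∈ α.1) (hl : Fin.last _ ∈ α.1)
      (hcl : c ≠ Fin.last _), φ α + φ (partnerRow α hc hl hcl) = c.val + 1)
    (α : GRow q) (c : Fin (2 * q + 1)) (s : ℤˣ) (a : Bool) (i : GVar q)
    (s' : ℤˣ) (b : Bool) (j : GVar q) (h1 : G q α c = .var s a i)
    (h2 : extraColumn q φ α = .var s' b j) : ∃ α' u u', G q α' c = .var u (!b) j ∧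
      extraColumn q φ α' = .var u' (!a) i ∧ s * s' * u * u' = -1 := by
  simp only [G_eq_var_iff, extraColumn_eq_var_iff] at *
  obtain ⟨hc, rfl, rfl, hi⟩ := h1
  obtain ⟨hl, rfl, rfl, hj⟩ := h2
  have hcl : c.castSucc ≠ Fin.last _ := (Fin.castSucc_lt_last c).ne
  have hlast : Fin.last _ ∈ partner α.1 c.castSucc (Fin.last _) := by
    rw [mem_partner]; simp
  refine ⟨partnerRow α hc hl hcl, _, _, ⟨?_, rfl, ?_, ?_⟩, ⟨?_, rfl, ?_, ?_⟩, ?_⟩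
  · simp [partnerRow, mem_partner]
  · simp [partnerRow, hlast]
  · simp only [partnerRow, if_pos hlast, erase_partner hc hcl, hj, compl_compl]
  · exact hlast
  · simp [hl]
  · rw [if_pos hl] at hi
    simp only [partnerRow, partner_comm α.1 c.castSucc, erase_partner hl hcl.symm, hi]
  · refine units_neg_one_pow_mul ?_
    have h3 := even_theta_block_last hc hl hcl
    have h4 := hφ α c.castSucc hc hl hcl
    have h5 : Odd ((φ α).val + (φ (partnerRow α hc hl hcl)).val + c.castSucc.val) := by
      rw [← ZMod.natCast_eq_one_iff_odd]
      push_cast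
      rw [ZMod.natCast_zmod_val, ZMod.natCast_zmod_val, h4, add_right_comm,
        CharTwo.add_self_eq_zero, zero_add]
    simp only [partnerRow] at h5 ⊢
    simp only [Nat.even_iff, Nat.odd_iff] at *
    omega

theorem isCOD_appendColumn {φ : GRow q → ZMod 2}
    (hφ : ∀ (α : GRow q) (c : Fin (2 * q + 2)) (hc : c ∈ α.1) (hl : Fin.last _ ∈ α.1)
      (hcl : c ≠ Fin.last _), φ α + φ (partnerRow α hc hl hcl) = c.val + 1) :
    IsCOD (appendColumn q (extraColumn q φ)) := by
  refine IsCOD.of_alamouti (fun c γ => ?_) fun α c d s a i s' b j hcd h1 h2 => ?_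
  · induction c using Fin.lastCases with
    | last => simpa using extraColumn_existsUnique_row φ γ
    | cast c => simpa using G_existsUnique_row c γ
  · induction c using Fin.lastCases with
    | last =>
      induction d using Fin.lastCases with
      | last => exact absurd rfl hcd
      | cast d =>
        simp only [appendColumn_castSucc, appendColumn_last] at *
        obtain ⟨α', u, u', h3, h4, h5⟩ := extraColumn_block hφ α d _ _ _ _ _ _ h2 h1
        exact ⟨α', u', u, h4, h3, by rw [← h5]; ac_rfl⟩
    | cast c =>
      induction d using Fin.lastCases with
      | last =>
        simp only [appendColumn_castSucc, appendColumn_last] at *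
        exact extraColumn_block hφ α c _ _ _ _ _ _ h1 h2
      | cast d =>
        simp only [appendColumn_castSucc] at *
        exact G_block α c d _ _ _ _ _ _ (fun h => hcd (by rw [h])) h1 h2

theorem exists_isCOD_appendColumn (hq : Even (q + 1)) :
    ∃ φ : GRow q → ZMod 2, IsCOD (appendColumn q (extraColumn q φ)) := by
  -- The sign is the parity of the sum of the 1-based positions of the bits. Over a row and its
  -- partner this adds up to the sum of all positions, `(q + 1)(2q + 3)`, plus those of `c` and of
  -- the last bit. The first is even because `q + 1` is, and the last position `2q + 2` is even, so
  -- `c + 1` remains.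
  refine ⟨fun α => ∑ x ∈ α.1, ((x.val : ZMod 2) + 1), isCOD_appendColumn ?_⟩
  intro α c hc hl hcl
  simp only [partnerRow]
  rw [← Finset.sum_union_inter, union_partner, inter_partner hc hl, Finset.sum_pair hcl]
  have h1 : ∑ x : Fin (2 * q + 2), ((x.val : ZMod 2) + 1) = 0 := by
    rw [Fin.sum_univ_eq_sum_range (fun x => (x : ZMod 2) + 1) (2 * q + 2)]
    obtain ⟨k, hk⟩ := hq
    have h2 : 2 * q + 2 = 4 * k := by omega
    rw [h2]
    clear h2 hk
    induction k with
    | zero => simp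
    | succ k ih =>
      rw [show 4 * (k + 1) = 4 * k + 1 + 1 + 1 + 1 by ring]
      simp only [Finset.sum_range_succ, ih]
      push_cast
      have e : (2 : ZMod 2) = 0 := rfl
      linear_combination (8 * k + 5 : ZMod 2) * e
  have h3 : ((2 * q + 1 : ℕ) : ZMod 2) + 1 = 0 := by
    push_cast
    have e : (2 : ZMod 2) = 0 := rfl
    linear_combination (q + 1 : ZMod 2) * e
  rw [h1, zero_add, Fin.val_last, h3, add_zero]

/-! ### Sign equivalence and the equivalence operations -/

section Equivalence

variable {ρ ι κ ρ' κ' ρ'' κ'' : Type}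

theorem SignEquivalent.symm {O : Matrix ρ ι (Entry κ)} {O' : Matrix ρ' ι (Entry κ')}
    (h : SignEquivalent O O') : SignEquivalent O' O := by
  obtain ⟨a, f, y, w, x, t, h⟩ := h
  refine ⟨a.symm, f.symm, y ∘ a.symm, w, x ∘ f.symm, t ∘ f.symm, fun r c => ?_⟩
  obtain ⟨r, rfl⟩ := a.surjective r
  rw [h, a.symm_apply_apply]
  cases O r c with
  | zero => rfl
  | var s b i =>
    have h1 : y r * w c * x i * (y r * w c * x i * s) = s := by
      rw [← mul_assoc, Int.units_mul_self, one_mul]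
    simp [Entry.twist, Entry.rename, h1]

theorem SignEquivalent.trans {O : Matrix ρ ι (Entry κ)} {O' : Matrix ρ' ι (Entry κ')}
    {O'' : Matrix ρ'' ι (Entry κ'')} (h : SignEquivalent O O') (h' : SignEquivalent O' O'') :
    SignEquivalent O O'' := by
  obtain ⟨a, f, y, w, x, t, h⟩ := h
  obtain ⟨a', f', y', w', x', t', h'⟩ := h'
  refine ⟨a.trans a', f.trans f', fun r => y' (a r) * y r, fun c => w' c * w c,
    fun i => x' (f i) * x i, fun i => xor (t' (f i)) (t i), fun r c => ?_⟩
  rw [Equiv.trans_apply, h', h]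
  cases O r c with
  | zero => rfl
  | var s b i =>
    simp only [Entry.twist, Entry.rename, Equiv.trans_apply, Bool.xor_assoc]
    congr 1
    ac_rfl

theorem units_cast_mul_self (v : ℤˣ) : ((v : ℤ) : ℂ) * ((v : ℤ) : ℂ) = 1 := by
  rcases Int.units_eq_one_or v with rfl | rfl <;> simp

theorem IsCOD.of_signEquivalent [Fintype ρ] [DecidableEq ι] [Fintype κ] [Fintype ρ'] [Fintype κ']
    {O : Matrix ρ ι (Entry κ)} {O' : Matrix ρ' ι (Entry κ')} (hO : IsCOD O)
    (h : SignEquivalent O O') : IsCOD O' := by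
  obtain ⟨a, f, y, w, x, t, h⟩ := h
  rw [isCOD_iff] at *
  intro z c c'
  -- Negations and conjugations of variables are absorbed into the values substituted, without
  -- changing their norms.
  let z' : κ → ℂ := fun i => ((x i : ℤ) : ℂ) * if t i then star (z (f i)) else z (f i)
  have h1 : ∀ r c, (O' (a r) c).eval z =
      ((y r : ℤ) : ℂ) * ((w c : ℤ) : ℂ) * (O r c).eval z' := by
    intro r c
    rw [h]
    cases O r c with
    | zero => simp [Entry.twist, Entry.rename, Entry.eval]
    | var s b i =>
      simp only [Entry.twist, Entry.rename, Entry.eval, z']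
      cases t i <;> cases b <;> simp <;> ring
  have h2 : ∀ i, ‖z' i‖ = ‖z (f i)‖ := by
    intro i
    rcases Int.units_eq_one_or (x i) with hx | hx <;> cases ht : t i <;> simp [z', hx, ht]
  rw [← a.sum_comp]
  have h3 : ∀ r, star ((O' (a r) c).eval z) * (O' (a r) c').eval z =
      ((w c : ℤ) : ℂ) * ((w c' : ℤ) : ℂ) * (star ((O r c).eval z') * (O r c').eval z') := by
    intro r
    rw [h1, h1]
    have hy := units_cast_mul_self (y r)
    simp only [star_mul', Complex.star_def, map_intCast]
    linear_combination ((w c : ℤ) : ℂ) * ((w c' : ℤ) : ℂ) *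
      ((starRingEnd ℂ) ((O r c).eval z') * (O r c').eval z') * hy
  rw [Finset.sum_congr rfl fun r _ => h3 r, ← Finset.mul_sum, hO z' c c']
  split_ifs with hc
  · subst hc
    rw [units_cast_mul_self, one_mul, ← f.sum_comp]
    simp only [h2]
  · rw [mul_zero]

theorem IsCOD.submatrix_columns [Fintype ρ] [DecidableEq ι] [Fintype κ] {ι' : Type}
    [DecidableEq ι'] {O : Matrix ρ ι (Entry κ)} (hO : IsCOD O) {e : ι' → ι}
    (he : Function.Injective e) : IsCOD (O.submatrix id e) := by
  rw [isCOD_iff] at *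
  intro z c c'
  simpa [he.eq_iff] using hO z (e c) (e c')

variable [DecidableEq ρ] [DecidableEq ι] [DecidableEq κ]

/-- One operation changes one row, so the rows are treated successively by induction on a finite
set. Columns and variables are handled in the same way below. -/
theorem reflTransGen_twist_row [Fintype ρ] (M : Matrix ρ ι (Entry κ)) (y : ρ → ℤˣ) :
    Relation.ReflTransGen EquivOp M
      (Matrix.of fun r c => (M r c).twist (y r) 1 fun _ => false) := by
  suffices h : ∀ s : Finset ρ, Relation.ReflTransGen EquivOp M
      (Matrix.of fun r c => (M r c).twist (if r ∈ s then y r else 1) 1 fun _ => false) by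
    simpa using h Finset.univ
  intro s
  induction s using Finset.induction_on with
  | empty =>
    convert Relation.ReflTransGen.refl
    ext r c
    cases h : M r c <;> simp [Entry.twist, h]
  | insert r₀ s hr₀ ih =>
    rcases Int.units_eq_one_or (y r₀) with hy | hy
    · convert ih using 5 with r c
      by_cases hr : r = r₀
      · simp [hr, hy]
      · simp [hr]
    · refine ih.tail ?_
      convert EquivOp.rowNegation (ρ := ρ) (ι := ι) (κ := κ) _ r₀ using 1
      ext r c
      by_cases hr : r = r₀
      · subst hr
        cases h : M r c <;> simp [Entry.twist, Entry.neg, h, hr₀, hy]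
      · simp [hr]

theorem reflTransGen_twist_column [Fintype ι] (M : Matrix ρ ι (Entry κ)) (w : ι → ℤˣ) :
    Relation.ReflTransGen EquivOp M
      (Matrix.of fun r c => (M r c).twist (w c) 1 fun _ => false) := by
  suffices h : ∀ s : Finset ι, Relation.ReflTransGen EquivOp M
      (Matrix.of fun r c => (M r c).twist (if c ∈ s then w c else 1) 1 fun _ => false) by
    simpa using h Finset.univ
  intro s
  induction s using Finset.induction_on with
  | empty =>
    convert Relation.ReflTransGen.refl
    ext r c
    cases h : M r c <;> simp [Entry.twist, h]
  | insert c₀ s hc₀ ih =>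
    rcases Int.units_eq_one_or (w c₀) with hw | hw
    · convert ih using 5 with r c
      by_cases hc : c = c₀
      · simp [hc, hw]
      · simp [hc]
    · refine ih.tail ?_
      convert EquivOp.columnNegation (ρ := ρ) (ι := ι) (κ := κ) _ c₀ using 1
      ext r c
      by_cases hc : c = c₀
      · subst hc
        cases h : M r c <;> simp [Entry.twist, Entry.neg, h, hc₀, hw]
      · simp [hc]

theorem reflTransGen_twist_negVar [Fintype κ] (M : Matrix ρ ι (Entry κ)) (x : κ → ℤˣ) :
    Relation.ReflTransGen EquivOp M
      (Matrix.of fun r c => (M r c).twist 1 x fun _ => false) := by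
  suffices h : ∀ s : Finset κ, Relation.ReflTransGen EquivOp M
      (Matrix.of fun r c => (M r c).twist 1 (fun i => if i ∈ s then x i else 1)
        fun _ => false) by
    simpa using h Finset.univ
  intro s
  induction s using Finset.induction_on with
  | empty =>
    convert Relation.ReflTransGen.refl
    ext r c
    cases h : M r c <;> simp [Entry.twist, h]
  | insert j s hj ih =>
    rcases Int.units_eq_one_or (x j) with hx | hx
    · convert ih using 6 with r c i
      by_cases hi : i = j
      · simp [hi, hx]
      · simp [hi]
    · refine ih.tail ?_
      convert EquivOp.instanceNegation (ρ := ρ) (ι := ι) (κ := κ) _ j using 1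
      ext r c
      cases h : M r c with
      | zero => simp [Entry.twist, Entry.negVar, h]
      | var s b i =>
        by_cases hi : i = j
        · subst hi
          simp [Entry.twist, Entry.negVar, h, hj, hx]
        · simp [Entry.twist, Entry.negVar, h, hi]

theorem reflTransGen_twist_conjVar [Fintype κ] (M : Matrix ρ ι (Entry κ)) (t : κ → Bool) :
    Relation.ReflTransGen EquivOp M (Matrix.of fun r c => (M r c).twist 1 1 t) := by
  suffices h : ∀ s : Finset κ, Relation.ReflTransGen EquivOp M
      (Matrix.of fun r c => (M r c).twist 1 1 (fun i => if i ∈ s then t i else false)) by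
    simpa using h Finset.univ
  intro s
  induction s using Finset.induction_on with
  | empty =>
    convert Relation.ReflTransGen.refl
    ext r c
    cases h : M r c <;> simp [Entry.twist, h]
  | insert j s hj ih =>
    cases ht : t j with
    | false =>
      convert ih using 6 with r c i
      by_cases hi : i = j
      · simp [hi, ht]
      · simp [hi]
    | true =>
      refine ih.tail ?_
      convert EquivOp.instanceConjugation (ρ := ρ) (ι := ι) (κ := κ) _ j using 1
      ext r c
      cases h : M r c with
      | zero => simp [Entry.twist, Entry.conjVar, h]
      | var s b i =>
        by_cases hi : i = j
        · subst hi
          simp [Entry.twist, Entry.conjVar, h, hj, ht]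
        · simp [Entry.twist, Entry.conjVar, h, hi]

theorem SignEquivalent.equivalent [Fintype ρ] [Fintype ι] [Fintype κ]
    {O : Matrix ρ' ι (Entry κ')} {O' : Matrix ρ ι (Entry κ)} (h : SignEquivalent O O') :
    Equivalent O O' := by
  obtain ⟨a, f, y, w, x, t, h⟩ := h
  refine ⟨a, Equiv.refl _, f, ?_⟩
  refine (((reflTransGen_twist_row _ (y ∘ a.symm)).trans (reflTransGen_twist_column _ w)).trans
    (reflTransGen_twist_negVar _ (x ∘ f.symm))).trans ?_
  convert reflTransGen_twist_conjVar _ (t ∘ f.symm) using 1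
  ext r c
  obtain ⟨r, rfl⟩ := a.surjective r
  rw [h]
  cases hO : O r c with
  | zero => simp [Entry.twist, Entry.rename, hO]
  | var s b i =>
    simp [Entry.twist, Entry.rename, hO]
    ac_rfl

end Equivalence

/-! ### Rigidity of the additional column -/

section ExtraColumn

variable {q : ℕ}

theorem G_conj {α : GRow q} {c : Fin (2 * q + 1)} {s : ℤˣ} {b : Bool} {γ : GVar q}
    (h : G q α c = .var s b γ) : b = decide (c.castSucc ∈ γ.1) := by
  obtain ⟨-, -, h2, h3⟩ := G_eq_var_iff.1 h
  rw [h2, h3]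
  split_ifs with h4 <;> simp [h4]

/-- By the Alamouti condition `z_γ` has conjugation opposite to `b` in each column of `G` meeting
the row `α`, while in `G` it is conjugated exactly in the columns belonging to `γ`. So `α` lies in
`γ ∪ {last}` or in the complement of `γ`. The latter has only `q + 1` elements, too few, and the
former has exactly `q + 2`. -/
theorem eq_insert_of_isCOD_appendColumn {L : GRow q → Entry (GVar q)}
    (h : IsCOD (appendColumn q L)) {α : GRow q} {s : ℤˣ} {b : Bool} {γ : GVar q}
    (hα : L α = .var s b γ) : b = false ∧ α.1 = insert (Fin.last _) γ.1 := by
  rw [← appendColumn_last L] at hα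
  obtain ⟨h1, -, h2⟩ := h.eq_row_sgn_cj hα
  have h3 : ∀ c : Fin (2 * q + 1), c.castSucc ∈ α.1 → decide (c.castSucc ∈ γ.1) = !b := by
    intro c hc
    have h4 : appendColumn q L α c.castSucc ≠ .zero := by
      rw [appendColumn_castSucc]
      simp only [G, Matrix.of_apply]
      split_ifs <;> simp
    obtain ⟨j, hj⟩ := h.exists_row_eq h4
    have h5 := (h.alamouti (Fin.castSucc_lt_last c).ne (hj.trans h1)).2.2.1
    have h6 := h.entry c.castSucc γ
    rw [appendColumn_castSucc] at h6
    rw [← G_conj h6, h2, h5, Bool.not_not]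
  cases b with
  | false =>
    refine ⟨rfl, Finset.eq_of_subset_of_card_le (fun x hx => ?_) ?_⟩
    · induction x using Fin.lastCases with
      | last => exact Finset.mem_insert_self _ _
      | cast c => exact Finset.mem_insert_of_mem (by simpa using h3 c hx)
    · rw [Finset.card_insert_of_notMem γ.2.2, γ.2.1, α.2]
  | true =>
    exfalso
    have h4 : α.1 ⊆ γ.1ᶜ := by
      intro x hx
      rw [Finset.mem_compl]
      induction x using Fin.lastCases with
      | last => exact γ.2.2
      | cast c => simpa using h3 c hx
    have h5 := Finset.card_le_card h4
    rw [Finset.card_compl, γ.2.1, α.2, Fintype.card_fin] at h5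
    omega

theorem exists_eq_extraColumn {L : GRow q → Entry (GVar q)} (h : IsCOD (appendColumn q L)) :
    ∃ φ : GRow q → ZMod 2, L = extraColumn q φ := by
  have key : ∀ α, ∃ v : ZMod 2, ∀ φ : GRow q → ZMod 2, φ α = v → L α = extraColumn q φ α := by
    intro α
    by_cases hl : Fin.last _ ∈ α.1
    · let γ : GVar q := ⟨α.1.erase (Fin.last _), card_erase_gRow α hl, Finset.notMem_erase _ _⟩
      have h1 := h.entry (Fin.last _) γ
      rw [appendColumn_last] at h1
      obtain ⟨h2, h3⟩ := eq_insert_of_isCOD_appendColumn h h1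
      rw [Finset.insert_erase hl] at h3
      rw [Subtype.ext h3, h2] at h1
      obtain ⟨v, hv⟩ : ∃ v : ZMod 2, h.sgn (Fin.last _) γ = (-1) ^ v.val := by
        rcases Int.units_eq_one_or (h.sgn (Fin.last _) γ) with h4 | h4
        · exact ⟨0, by rw [h4]; rfl⟩
        · exact ⟨1, by rw [h4]; rfl⟩
      refine ⟨v, fun φ hφ => ?_⟩
      rw [h1, eq_comm, extraColumn_eq_var_iff]
      exact ⟨hl, by rw [hv, hφ], rfl, rfl⟩
    · refine ⟨0, fun φ _ => ?_⟩
      cases hL : L α with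
      | zero => simp [extraColumn, hl]
      | var s b γ =>
        have h1 := (eq_insert_of_isCOD_appendColumn h hL).2
        rw [h1] at hl
        simp at hl
  choose φ hφ using key
  exact ⟨φ, funext fun α => hφ α φ rfl⟩

theorem extraColumn_sign {φ : GRow q → ZMod 2} (h : IsCOD (appendColumn q (extraColumn q φ)))
    (α : GRow q) {c : Fin (2 * q + 1)} (hc : c.castSucc ∈ α.1) (hl : Fin.last _ ∈ α.1) :
    (-1 : ℤˣ) ^ theta α.1 c.castSucc * (-1) ^ (φ α).val *
      (-1) ^ theta (partner α.1 c.castSucc (Fin.last _)) c.castSucc *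
      (-1) ^ (φ (partnerRow α hc hl (Fin.castSucc_lt_last c).ne)).val = -1 := by
  have hcl : c.castSucc ≠ Fin.last _ := (Fin.castSucc_lt_last c).ne
  let i : GVar q := ⟨(α.1.erase c.castSucc)ᶜ, card_erase_compl_gRow α hc, by
    simpa using ⟨hcl.symm, hl⟩⟩
  let j : GVar q := ⟨α.1.erase (Fin.last _), card_erase_gRow α hl, Finset.notMem_erase _ _⟩
  have hlast : Fin.last _ ∈ partner α.1 c.castSucc (Fin.last _) := by simp [mem_partner]
  have e1 := (appendColumn_castSucc (extraColumn q φ) α c).trans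
    (G_eq_var_iff (γ := i).2 ⟨hc, rfl, rfl, by rw [if_pos hl]⟩)
  have e2 := (appendColumn_last (extraColumn q φ) α).trans
    (extraColumn_eq_var_iff (γ := j).2 ⟨hl, rfl, rfl, rfl⟩)
  have e3 := (appendColumn_castSucc (extraColumn q φ) (partnerRow α hc hl hcl) c).trans
    (G_eq_var_iff (γ := j).2 ⟨by simp [partnerRow, mem_partner], rfl, rfl, by
      simp only [partnerRow, if_pos hlast, erase_partner hc hcl, compl_compl, j]⟩)
  have e4 := (appendColumn_last (extraColumn q φ) (partnerRow α hc hl hcl)).trans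
    (extraColumn_eq_var_iff (γ := i).2 ⟨hlast, rfl, rfl, by
      simp only [partnerRow, partner_comm α.1 c.castSucc, erase_partner hl hcl.symm, i]⟩)
  obtain ⟨r1, s1, -⟩ := h.eq_row_sgn_cj e1
  obtain ⟨r2, s2, -⟩ := h.eq_row_sgn_cj e2
  obtain ⟨-, s3, -⟩ := h.eq_row_sgn_cj e3
  obtain ⟨-, s4, -⟩ := h.eq_row_sgn_cj e4
  have h1 := (h.alamouti hcl (r1.symm.trans r2)).2.2.2
  rw [← s1, ← s2, ← s3, ← s4] at h1
  exact h1

/-- The block with columns `c` and last fixes the relative sign of a row and its partner, so `φ' -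
φ` agrees on partners. Two partner steps exchange one bit of a row and keep the last bit, and such
exchanges connect all rows containing the last bit. -/
theorem extraColumn_sign_unique {φ φ' : GRow q → ZMod 2}
    (h : IsCOD (appendColumn q (extraColumn q φ)))
    (h' : IsCOD (appendColumn q (extraColumn q φ'))) :
    (∀ α : GRow q, Fin.last (2 * q + 1) ∈ α.1 → φ' α = φ α) ∨
      (∀ α : GRow q, Fin.last (2 * q + 1) ∈ α.1 → φ' α = φ α + 1) := by
  have step : ∀ (α : GRow q) (c : Fin (2 * q + 2)) (hc : c ∈ α.1) (hl : Fin.last _ ∈ α.1)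
      (hcl : c ≠ Fin.last _), φ' (partnerRow α hc hl hcl) - φ (partnerRow α hc hl hcl) =
        φ' α - φ α := by
    intro α c hc hl hcl
    obtain ⟨c, rfl⟩ : ∃ d : Fin (2 * q + 1), d.castSucc = c := Fin.exists_castSucc_eq.2 hcl
    have h1 := (extraColumn_sign h α hc hl).trans (extraColumn_sign h' α hc hl).symm
    generalize φ (partnerRow α hc hl _) = v1 at *
    generalize φ' (partnerRow α hc hl _) = v2 at *
    generalize φ α = v3 at *
    generalize φ' α = v4 at *
    generalize (-1 : ℤˣ) ^ theta α.1 c.castSucc = t1 at *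
    generalize (-1 : ℤˣ) ^ theta (partner α.1 c.castSucc (Fin.last _)) c.castSucc = t2 at *
    have h2 : (-1 : ℤˣ) ^ v3.val * (-1) ^ v1.val = (-1) ^ v4.val * (-1) ^ v2.val := by
      apply mul_left_cancel (a := t1 * t2)
      calc _ = t1 * (-1) ^ v3.val * t2 * (-1) ^ v1.val := by ac_rfl
        _ = _ := by rw [h1]; ac_rfl
    clear h1
    revert v1 v2 v3 v4
    decide
  by_cases hex : ∃ α : GRow q, Fin.last _ ∈ α.1
  swap
  · exact .inl fun α hα => absurd ⟨α, hα⟩ hex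
  obtain ⟨α, hα⟩ := hex
  have key : ∀ β : GRow q, Fin.last _ ∈ β.1 → φ' β - φ β = φ' α - φ α := by
    intro β hβ
    refine (exchange_induction (B := β.1) (fun A => Fin.last _ ∈ A ∧ ∀ hA : A.card = q + 2,
      φ' ⟨A, hA⟩ - φ ⟨A, hA⟩ = φ' α - φ α) ?_ (A := α.1) (by rw [α.2, β.2])
      ⟨hα, fun _ => rfl⟩).2 β.2
    rintro A c d hA - hc hd hdβ ⟨hl, h1⟩
    rw [β.2] at hA
    have hdl : d ≠ Fin.last _ := by rintro rfl; exact hdβ hβ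
    have hcl : c ≠ Fin.last _ := by rintro rfl; exact hc hl
    refine ⟨by simp [hl, hdl.symm], fun hA' => ?_⟩
    have hc' : c ∈ partner A d (Fin.last _) := by simp [mem_partner, hc]
    have hl' : Fin.last _ ∈ partner A d (Fin.last _) := by simp [mem_partner]
    have h2 := step (partnerRow ⟨A, hA⟩ hd hl hdl) c hc' hl' hcl
    rw [step ⟨A, hA⟩ d hd hl hdl, h1 hA] at h2
    rw [← h2]
    -- Two complementations cancel: the first step removes `d` from the twice complemented set, the
    -- second adds `c`.
    have h3 : partnerRow (partnerRow ⟨A, hA⟩ hd hl hdl) hc' hl' hcl =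
        ⟨insert c (A.erase d), hA'⟩ := by
      apply Subtype.ext
      ext x
      simp only [partnerRow, mem_partner, Finset.mem_insert, Finset.mem_erase]
      grind
    rw [h3]
  have h01 : ∀ v : ZMod 2, v = 0 ∨ v = 1 := by decide
  rcases h01 (φ' α - φ α) with h0 | h0
  · left
    intro β hβ
    rw [← sub_eq_zero, key β hβ, h0]
  · right
    intro β hβ
    rw [← sub_eq_iff_eq_add', key β hβ, h0]

theorem signEquivalent_appendColumn {φ φ' : GRow q → ZMod 2}
    (h : IsCOD (appendColumn q (extraColumn q φ)))
    (h' : IsCOD (appendColumn q (extraColumn q φ'))) :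
    SignEquivalent (appendColumn q (extraColumn q φ)) (appendColumn q (extraColumn q φ')) := by
  obtain ⟨ε, hε⟩ : ∃ ε : ℤˣ, ∀ α : GRow q, Fin.last _ ∈ α.1 →
      (-1 : ℤˣ) ^ (φ' α).val = ε * (-1) ^ (φ α).val := by
    rcases extraColumn_sign_unique h h' with h1 | h1
    · exact ⟨1, fun α hα => by rw [h1 α hα, one_mul]⟩
    · refine ⟨-1, fun α hα => ?_⟩
      rw [h1 α hα]
      generalize φ α = v
      revert v
      decide
  refine ⟨Equiv.refl _, Equiv.refl _, 1, fun c => if c = Fin.last _ then ε else 1, 1,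
    fun _ => false, fun α c => ?_⟩
  induction c using Fin.lastCases with
  | last =>
    simp only [Equiv.refl_apply, appendColumn_last, extraColumn]
    split_ifs with hl
    · simp [Entry.twist, Entry.rename, hε α hl]
    · rfl
  | cast c =>
    simp only [Equiv.refl_apply, appendColumn_castSucc, if_neg (Fin.castSucc_lt_last c).ne]
    cases G q α c <;> simp [Entry.twist, Entry.rename]

end ExtraColumn

/-! ### Parameters and optimality -/

theorem card_GRow (q : ℕ) : Fintype.card (GRow q) = (2 * q + 2).choose q := by
  rw [Fintype.card_subtype]
  have h1 : (Finset.univ.filter fun α : Finset (Fin (2 * q + 2)) => α.card = q + 2) =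
      Finset.powersetCard (q + 2) Finset.univ := by
    ext; simp [Finset.mem_powersetCard]
  rw [h1, Finset.card_powersetCard, Finset.card_univ, Fintype.card_fin,
    Nat.choose_symm_of_eq_add (show 2 * q + 2 = q + 2 + q by omega)]

theorem card_GVar (q : ℕ) : Fintype.card (GVar q) = (2 * q + 1).choose q := by
  rw [Fintype.card_subtype]
  have h1 : (Finset.univ.filter fun γ : Finset (Fin (2 * q + 2)) =>
      γ.card = q + 1 ∧ Fin.last (2 * q + 1) ∉ γ) =
      Finset.powersetCard (q + 1) (Finset.univ.erase (Fin.last _)) := by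
    ext γ
    simp only [Finset.mem_filter, Finset.mem_univ, true_and, Finset.mem_powersetCard,
      Finset.subset_erase, Finset.subset_univ]
    tauto
  rw [h1, Finset.card_powersetCard, Finset.card_erase_of_mem (Finset.mem_univ _),
    Finset.card_univ, Fintype.card_fin, Nat.add_sub_assoc (by omega),
    Nat.choose_symm_of_eq_add (show 2 * q + (2 - 1) = q + 1 + q by omega)]

theorem rate_identity (q : ℕ) :
    (q + 2) * (2 * q + 2).choose q = (2 * q + 2) * (2 * q + 1).choose q := by
  have h1 := Nat.add_one_mul_choose_eq (2 * q + 1) (q + 1)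
  rw [← Nat.choose_symm_of_eq_add (show 2 * q + 2 = q + (q + 2) by omega),
    ← Nat.choose_symm_of_eq_add (show 2 * q + 1 = q + (q + 1) by omega)] at h1
  rw [h1, mul_comm]

section Optimal

variable {ρ ι κ ρ' κ' : Type} [Fintype ρ] [DecidableEq ι] [Fintype κ] [Fintype ρ'] [Fintype κ']
  {q : ℕ} {e : Fin (2 * q + 1) → ι} (he : Function.Injective e)

include he

/-- The injection `e` selects `2q + 1` columns, so the odd bound applies to `2q + 1` and to `2q + 2`
columns alike. -/
theorem isMaxRate_of_card {W : Matrix ρ ι (Entry κ)} (hW : IsCOD W)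
    (hρ : Fintype.card ρ = (2 * q + 2).choose q) (hκ : Fintype.card κ = (2 * q + 1).choose q) :
    IsMaxRate W := by
  refine ⟨hW, fun p k O' hO' => ?_⟩
  have h1 := (hO'.submatrix_columns he).rate_bound (Fintype.card_fin (2 * q + 1))
  rw [Fintype.card_fin, Fintype.card_fin] at h1
  have h2 := rate_identity q
  have hP : 0 < (2 * q + 2).choose q := Nat.choose_pos (by omega)
  rw [← hρ] at h2 hP
  rw [← hκ] at h2
  rcases Nat.eq_zero_or_pos p with rfl | hp
  -- A design without rows has rate `k / 0 = 0` by convention.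
  · simp only [Nat.cast_zero, div_zero]
    positivity
  rw [div_le_div_iff₀ (by exact_mod_cast hp) (by exact_mod_cast hP)]
  have h3 : k * Fintype.card ρ ≤ Fintype.card κ * p := by
    refine Nat.le_of_mul_le_mul_left (c := 2 * q + 2) ?_ (by omega)
    calc _ = (2 * q + 2) * k * Fintype.card ρ := by ring
      _ ≤ (q + 2) * p * Fintype.card ρ := Nat.mul_le_mul_right _ h1
      _ = (q + 2) * Fintype.card ρ * p := by ring
      _ = _ := by rw [h2]; ring
  exact_mod_cast h3

omit he in
theorem exists_fin_relabelling {W : Matrix ρ ι (Entry κ)} (hW : IsCOD W) :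
    ∃ W' : Matrix (Fin (Fintype.card ρ)) ι (Entry (Fin (Fintype.card κ))), IsCOD W' := by
  refine ⟨_, hW.of_signEquivalent (O' := (W.submatrix (Fintype.equivFin ρ).symm id).map
    (Entry.rename (Fintype.equivFin κ))) ⟨Fintype.equivFin ρ, Fintype.equivFin κ, 1, 1, 1,
    fun _ => false, fun r c => ?_⟩⟩
  cases h : W r c <;> simp [Entry.twist, h]

omit he in
-- The design `W` shows that the bound is attained, so a maximal-rate design attains it too; its
-- rate is positive, so it has a variable.
theorem IsMaxRate.rate {W : Matrix ρ ι (Entry κ)} (hW : IsCOD W)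
    (hρ : Fintype.card ρ = (2 * q + 2).choose q) (hκ : Fintype.card κ = (2 * q + 1).choose q)
    {O : Matrix ρ' ι (Entry κ')} (hO : IsMaxRate O) : 0 < Fintype.card κ' ∧
      (q + 2) * Fintype.card ρ' ≤ (2 * q + 2) * Fintype.card κ' := by
  obtain ⟨W', hW'⟩ := exists_fin_relabelling hW
  have h1 := hO.2 _ _ W' hW'
  have h2 := rate_identity q
  have hP : 0 < (2 * q + 2).choose q := Nat.choose_pos (by omega)
  have hK : 0 < (2 * q + 1).choose q := Nat.choose_pos (by omega)
  rw [← hρ] at h2 hP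
  rw [← hκ] at h2 hK
  have h3 : (0 : ℚ) < Fintype.card κ' / Fintype.card ρ' :=
    lt_of_lt_of_le (by positivity) h1
  have hP' : 0 < Fintype.card ρ' := by
    rcases Nat.eq_zero_or_pos (Fintype.card ρ') with h | h
    · rw [h] at h3; simp at h3
    · exact h
  rw [div_le_div_iff₀ (by exact_mod_cast hP) (by exact_mod_cast hP')] at h1
  have h4 : Fintype.card κ * Fintype.card ρ' ≤ Fintype.card κ' * Fintype.card ρ := by
    exact_mod_cast h1
  constructor
  · rcases Nat.eq_zero_or_pos (Fintype.card κ') with h | h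
    · rw [h] at h3; simp at h3
    · exact h
  · refine Nat.le_of_mul_le_mul_left (c := Fintype.card ρ) ?_ hP
    calc _ = (q + 2) * Fintype.card ρ * Fintype.card ρ' := by ring
      _ = (2 * q + 2) * (Fintype.card κ * Fintype.card ρ') := by rw [h2]; ring
      _ ≤ (2 * q + 2) * (Fintype.card κ' * Fintype.card ρ) := Nat.mul_le_mul_left _ h4
      _ = _ := by ring

theorem isOptimal_of_card {W : Matrix ρ ι (Entry κ)} (hW : IsCOD W)
    (hρ : Fintype.card ρ = (2 * q + 2).choose q) (hκ : Fintype.card κ = (2 * q + 1).choose q) :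
    IsOptimal W := by
  refine ⟨isMaxRate_of_card he hW hρ hκ, fun p k O' hO' => ?_⟩
  have h1 := hO'.rate hW hρ hκ
  have h2 := hO'.1.submatrix_columns he
  have h3 := h2.choose_le_card (Fintype.card_fin (2 * q + 1)) h1.2 h1.1
  have h4 := h2.rate_bound (Fintype.card_fin (2 * q + 1))
  rw [Fintype.card_fin] at h3 h4
  rw [Fintype.card_fin] at h4
  refine Nat.le_of_mul_le_mul_left (c := q + 2) ?_ (by omega)
  rw [hρ, rate_identity]
  exact (Nat.mul_le_mul_left _ h3).trans h4

/-- Comparison with the delay of `W` bounds the number of rows, hence of variables, from above;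
`choose_le_card` bounds the number of variables from below. -/
theorem IsOptimal.card {W : Matrix ρ ι (Entry κ)} (hW : IsCOD W)
    (hρ : Fintype.card ρ = (2 * q + 2).choose q) (hκ : Fintype.card κ = (2 * q + 1).choose q)
    {O : Matrix ρ' ι (Entry κ')} (hO : IsOptimal O) :
    Fintype.card κ' = (2 * q + 1).choose q ∧
      (q + 2) * Fintype.card ρ' ≤ (2 * q + 2) * Fintype.card κ' := by
  obtain ⟨W', hW'⟩ := exists_fin_relabelling hW
  have h1 := hO.1.rate hW hρ hκ
  have h2 := hO.1.1.submatrix_columns he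
  have h3 := h2.choose_le_card (Fintype.card_fin (2 * q + 1)) h1.2 h1.1
  have h4 := h2.rate_bound (Fintype.card_fin (2 * q + 1))
  have h5 := hO.2 _ _ W' (isMaxRate_of_card he hW' (by rw [Fintype.card_fin, hρ])
    (by rw [Fintype.card_fin, hκ]))
  refine ⟨le_antisymm ?_ h3, h1.2⟩
  refine Nat.le_of_mul_le_mul_left (c := 2 * q + 2) ?_ (by omega)
  rw [← rate_identity, ← hρ]
  exact h4.trans (Nat.mul_le_mul_left _ h5)

end Optimal

/-! ### Comparison with the model designs -/

variable {ρ κ : Type} [Fintype ρ] [Fintype κ] {q : ℕ}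

theorem signEquivalent_G {O : Matrix ρ (Fin (2 * q + 1)) (Entry κ)} (hO : IsCOD O)
    (hκ : Fintype.card κ = (2 * q + 1).choose q)
    (hr : (q + 2) * Fintype.card ρ ≤ (2 * q + 2) * Fintype.card κ) : SignEquivalent O (G q) :=
  hO.signEquivalent (Fintype.card_fin _) (isCOD_G q) hr
    (by rw [card_GRow, card_GVar, rate_identity]) hκ (card_GVar q)

theorem exists_signEquivalent_appendColumn {O : Matrix ρ (Fin (2 * q + 2)) (Entry κ)}
    (hO : IsCOD O) (hκ : Fintype.card κ = (2 * q + 1).choose q)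
    (hr : (q + 2) * Fintype.card ρ ≤ (2 * q + 2) * Fintype.card κ) :
    ∃ φ : GRow q → ZMod 2, IsCOD (appendColumn q (extraColumn q φ)) ∧
      SignEquivalent O (appendColumn q (extraColumn q φ)) := by
  obtain ⟨a, f, y, w, x, t, h⟩ := signEquivalent_G
    (hO.submatrix_columns (Fin.castSucc_injective (2 * q + 1))) hκ hr
  -- The relabelling and twist that carry the first `2q + 1` columns to `G` are applied to the last
  -- column as well.
  let L : GRow q → Entry (GVar q) := fun α =>
    ((O (a.symm α) (Fin.last _)).twist (y (a.symm α) * 1) x t).rename f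
  have h1 : SignEquivalent O (appendColumn q L) := by
    refine ⟨a, f, y, Fin.snoc (α := fun _ => ℤˣ) w 1, x, t, fun r c => ?_⟩
    induction c using Fin.lastCases with
    | last => simp [L]
    | cast c => simpa using h r c
  have h2 := hO.of_signEquivalent h1
  obtain ⟨φ, hφ⟩ := exists_eq_extraColumn h2
  rw [hφ] at h1 h2
  exact ⟨φ, h2, h1⟩

end COD

theorem mainTheorem4 :
    -- uniqueness of maximal-rate, minimal-delay designs
    (∀ n : ℕ, 0 < n → (n ≡ 0 [MOD 4] ∨ n ≡ 1 [MOD 4] ∨ n ≡ 3 [MOD 4]) →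
      ∀ (p k p' k' : ℕ) (O : Matrix (Fin p) (Fin n) (COD.Entry (Fin k)))
        (O' : Matrix (Fin p') (Fin n) (COD.Entry (Fin k'))),
        COD.IsOptimal O → COD.IsOptimal O' → COD.Equivalent O O') ∧
    -- odd number of columns `n = 2 m - 1`, with `m = q + 1`
    (∀ q : ℕ, COD.IsOptimal (COD.G q) ∧
      ∀ O : Matrix (Fin ((2 * q + 2).choose q)) (Fin (2 * q + 1))
          (COD.Entry (Fin ((2 * q + 1).choose q))),
        COD.IsCOD O → COD.Equivalent O (COD.G q)) ∧
    -- `n = 2 m` columns with `m = q + 1` even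
    (∀ q : ℕ, Even (q + 1) →
      (∃ L : COD.GRow q → COD.Entry (COD.GVar q), COD.IsCOD (COD.appendColumn q L)) ∧
      (∀ L : COD.GRow q → COD.Entry (COD.GVar q), COD.IsCOD (COD.appendColumn q L) →
        COD.IsOptimal (COD.appendColumn q L) ∧
          ∃ φ : COD.GRow q → ZMod 2, L = COD.extraColumn q φ) ∧
      (∀ φ φ' : COD.GRow q → ZMod 2,
        COD.IsCOD (COD.appendColumn q (COD.extraColumn q φ)) →
        COD.IsCOD (COD.appendColumn q (COD.extraColumn q φ')) →
        (∀ α : COD.GRow q, Fin.last (2 * q + 1) ∈ α.1 → φ' α = φ α) ∨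
          (∀ α : COD.GRow q, Fin.last (2 * q + 1) ∈ α.1 → φ' α = φ α + 1))) := by
  refine ⟨fun n hn hmod p k p' k' O O' hO hO' => ?_, fun q => ⟨?_, fun O hO => ?_⟩,
    fun q hq => ⟨?_, fun L hL => ⟨?_, COD.exists_eq_extraColumn hL⟩,
      fun φ φ' => COD.extraColumn_sign_unique⟩⟩
  · rcases Nat.even_or_odd' n with ⟨m, rfl | rfl⟩
    · obtain ⟨q, rfl⟩ : ∃ q, m = q + 1 := ⟨m - 1, by omega⟩
      have hq : Even (q + 1) := by
        rw [Nat.even_iff]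
        simp only [Nat.ModEq] at hmod
        omega
      -- This extension of `G` shows that with `2q + 2` columns the bounds for `2q + 1` columns are
      -- still attained.
      obtain ⟨ψ, hψ⟩ := COD.exists_isCOD_appendColumn hq
      have hinj := Fin.castSucc_injective (2 * q + 1)
      obtain ⟨h1, h2⟩ := hO.card hinj hψ (COD.card_GRow q) (COD.card_GVar q)
      obtain ⟨h3, h4⟩ := hO'.card hinj hψ (COD.card_GRow q) (COD.card_GVar q)
      obtain ⟨φ, hφ, h5⟩ := COD.exists_signEquivalent_appendColumn hO.1.1 h1 h2
      obtain ⟨φ', hφ', h6⟩ := COD.exists_signEquivalent_appendColumn hO'.1.1 h3 h4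
      exact ((h5.trans (COD.signEquivalent_appendColumn hφ hφ')).trans h6.symm).equivalent
    · have hinj : Function.Injective (id : Fin (2 * m + 1) → _) := Function.injective_id
      obtain ⟨h1, h2⟩ := hO.card hinj (COD.isCOD_G m) (COD.card_GRow m) (COD.card_GVar m)
      obtain ⟨h3, h4⟩ := hO'.card hinj (COD.isCOD_G m) (COD.card_GRow m) (COD.card_GVar m)
      exact ((COD.signEquivalent_G hO.1.1 h1 h2).trans
        (COD.signEquivalent_G hO'.1.1 h3 h4).symm).equivalent
  · exact COD.isOptimal_of_card Function.injective_id (COD.isCOD_G q) (COD.card_GRow q)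
      (COD.card_GVar q)
  · refine (COD.signEquivalent_G hO (Fintype.card_fin _) ?_).equivalent
    rw [Fintype.card_fin, Fintype.card_fin, COD.rate_identity]
  · obtain ⟨φ, hφ⟩ := COD.exists_isCOD_appendColumn hq
    exact ⟨_, hφ⟩
  · exact COD.isOptimal_of_card (Fin.castSucc_injective (2 * q + 1)) hL (COD.card_GRow q)
      (COD.card_GVar q)
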